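/- Let $M$ be a connected smooth ($C^\infty$, Hausdorff, second countable) manifold of dimension $m\ge 2$, and let $g$ be a smooth symmetric covariant $2$-tensor field on $M$. Let $\Sigma\subset M$ be the set of points where $g$ is degenerate and put $\mathbb M=M\setminus\Sigma$. Assume that $(M,g)$ is a transverse Riemann--Lorentz manifold: $\Sigma\neq\emptyset$; for every $p\in\Sigma$ one has $d_p(\det(g_{ab}))\neq 0$ in local coordinates around $p$; and $\Sigma$ separates a Riemannian part from a Lorentzian one, i.e. $g$ has index $0$ or $1$ at each point of $\mathbb M$, and every point of $\Sigma$ is a limit both of points of $\mathbb M$ of index $0$ and of points of $\mathbb M$ of index $1$. Then $\Sigma$ is an embedded hypersurface with $T_p\Sigma=\ker d_p(\det(g_{ab}))$, and $\mathrm{Rad}_p=\{v\in T_pM: g_p(v,\cdot)=0\}$ is a line for each $p\in\Sigma$. Assume further that the radical is transverse, i.e. $T_pM=\mathrm{Rad}_p\oplus T_p\Sigma$ for all $p\in\Sigma$. Let $\square$ be the dual connection $$\square_XY(Z)=\tfrac12\big(X\,g(Y,Z)+Y\,g(Z,X)-Z\,g(X,Y)+g([X,Y],Z)-g([Y,Z],X)+g([Z,X],Y)\big),$$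 so that on $\mathbb M$ one has $\square_XY(Z)=g(\nabla_XY,Z)$ with $\nabla$ the Levi-Civita connection of $g|_{\mathbb M}$. A radical vector field is a smooth vector field $R$ on $M$ with $R_p\in\mathrm{Rad}_p\setminus\{0\}$ for all $p\in\Sigma$; put $II^R(X,Y)=\square_XY(R)|_\Sigma$. The manifold $(M,g)$ is $II$-flat if radical vector fields exist and, for every (equivalently, some) radical vector field $R$, $II^R(X,Y)=0$ on $\Sigma$ for all smooth vector fields $X,Y$ on $M$ that are tangent to $\Sigma$ along $\Sigma$. It is $III$-flat if it is $II$-flat and, for every (equivalently, some) radical vector field $R$ and all such $X,Y$, the vector field $\nabla_XY$ on $\mathbb M$ extends to a smooth vector field on $M$, and $III^R(X,Y):=II^R(\nabla_XY,R)=0$ on $\Sigma$. If $(\mathbb M,g)$ is flat, i.e. the covariant curvature $K(X,Y,Z,T)=g(\nabla_X\nabla_YZ-\nabla_Y\nabla_XZ-\nabla_{[X,Y]}Z,\,T)$ vanishes on $\mathbb M$ for all smooth vector fields $X,Y,Z,T$ on $M$, then $(M,g)$ is $III$-flat, and $\Sigma$ is flat: $\Sigma$ is an embedded hypersurface of $M$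 on which $g$ induces a Riemannian metric $g_\Sigma$, and the curvature of $(\Sigma,g_\Sigma)$ vanishes identically. -/

import Mathlib

open scoped Manifold ContDiff Topology

noncomputable section

namespace RiemannLorentz

/-- Fields of bilinear forms on the tangent spaces of a `d`-dimensional manifold `M`
(no regularity and no symmetry is required at this point). -/
abbrev BilinField (d : ℕ) (M : Type*) [TopologicalSpace M]
    [ChartedSpace (EuclideanSpace ℝ (Fin d)) M] :=
  ∀ x : M, TangentSpace (𝓡 d) x →L[ℝ] TangentSpace (𝓡 d) x →L[ℝ] ℝ

/-- Vector fields on a `d`-dimensional manifold `M` (without regularity). -/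
abbrev VField (d : ℕ) (M : Type*) [TopologicalSpace M]
    [ChartedSpace (EuclideanSpace ℝ (Fin d)) M] :=
  ∀ x : M, TangentSpace (𝓡 d) x

section Basic

variable {d : ℕ} {M : Type*} [TopologicalSpace M] [ChartedSpace (EuclideanSpace ℝ (Fin d)) M]

/-- `X ∈ 𝔛(M)`: the vector field `X` is smooth. -/
def IsSmoothVField [IsManifold (𝓡 d) ∞ M] (X : VField d M) : Prop :=
  ContMDiff (𝓡 d) (𝓡 d).tangent ∞
    (fun x => (Bundle.TotalSpace.mk' (EuclideanSpace ℝ (Fin d)) x (X x) :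
      TangentBundle (𝓡 d) M))

/-- The field of bilinear forms `g` is smooth, as a section of the bundle of bilinear forms. -/
def IsSmoothBilinField [IsManifold (𝓡 d) ∞ M] (g : BilinField d M) : Prop :=
  ContMDiff (𝓡 d)
    ((𝓡 d).prod 𝓘(ℝ, EuclideanSpace ℝ (Fin d) →L[ℝ] EuclideanSpace ℝ (Fin d) →L[ℝ] ℝ)) ∞
    (fun x => Bundle.TotalSpace.mk'
      (E := fun x : M => TangentSpace (𝓡 d) x →L[ℝ] TangentSpace (𝓡 d) x →L[ℝ] ℝ)
      (EuclideanSpace ℝ (Fin d) →L[ℝ] EuclideanSpace ℝ (Fin d) →L[ℝ] ℝ) x (g x))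

/-- The derivative `X f` of a function `f` along a vector field `X`. -/
def dirDeriv (X : VField d M) (f : M → ℝ) (p : M) : ℝ :=
  mfderiv (𝓡 d) 𝓘(ℝ, ℝ) f p (X p)

/-- The radical of `g` at `p`: the vectors that are `g`-orthogonal to the whole tangent space. -/
def radical (g : BilinField d M) (p : M) : Submodule ℝ (TangentSpace (𝓡 d) p) :=
  LinearMap.ker (g p).toLinearMap

/-- `Σ`: the set of points where `g` degenerates. -/
def singularSet (g : BilinField d M) : Set M :=
  {p | radical g p ≠ ⊥}

/-- `𝕄 = M ∖ Σ`. -/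
def regularPart (g : BilinField d M) : Set M :=
  (singularSet g)ᶜ

/-- The quadratic form `v ↦ g_p(v, v)`. -/
def quadForm (g : BilinField d M) (p : M) : QuadraticForm ℝ (TangentSpace (𝓡 d) p) :=
  LinearMap.BilinMap.toQuadraticMap
    (LinearMap.mk₂ ℝ (fun v w => g p v w) (by simp) (by simp) (by simp) (by simp))

/-- The index of `g` at `p`: the maximal dimension of a negative definite subspace. -/
def index (g : BilinField d M) (p : M) : ℕ :=
  sigNeg (quadForm g p)

/-- The points at which `g` is Riemannian, that is nondegenerate of index `0`. -/
def riemannianPart (g : BilinField d M) : Set M :=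
  {p | p ∈ regularPart g ∧ index g p = 0}

/-- The points at which `g` is Lorentzian, that is nondegenerate of index `1`. -/
def lorentzianPart (g : BilinField d M) : Set M :=
  {p | p ∈ regularPart g ∧ index g p = 1}

/-- The `a`-th coordinate vector field of the preferred chart around `p`. -/
def coordField (p : M) (a : Fin d) : VField d M := fun x =>
  mfderiv (𝓡 d) (𝓡 d) (extChartAt (𝓡 d) p).symm (extChartAt (𝓡 d) p x)
    (EuclideanSpace.single a (1 : ℝ))

/-- `det (g_ab)` in the preferred chart around `p`, as a function on `M`
(meaningful on the chart domain only). -/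
def gramDet (g : BilinField d M) (p : M) (x : M) : ℝ :=
  (Matrix.of fun a b : Fin d => g x (coordField p a x) (coordField p b x)).det

/-- The tangent space `T_p Σ`, for `p ∈ Σ`: as `Σ` is, near `p`, the zero set of `det (g_ab)`
and `d_p (det (g_ab)) ≠ 0`, it is the kernel of that differential. -/
def tangentSigma (g : BilinField d M) (p : M) : Submodule ℝ (TangentSpace (𝓡 d) p) :=
  LinearMap.ker (mfderiv (𝓡 d) 𝓘(ℝ, ℝ) (gramDet g p) p).toLinearMap

/-- `(M, g)` is a transverse Riemann-Lorentz manifold: `g` is a smooth symmetric covariant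
`2`-tensor field, the set `Σ` of its degenerate points is not empty, `d_p (det (g_ab)) ≠ 0` at
every `p ∈ Σ`, and `Σ` separates a Riemannian part from a Lorentzian one. -/
structure IsTransverseRiemannLorentz [IsManifold (𝓡 d) ∞ M] (g : BilinField d M) : Prop where
  smooth : IsSmoothBilinField g
  symm : ∀ (p : M) (v w : TangentSpace (𝓡 d) p), g p v w = g p w v
  nonempty : (singularSet g).Nonempty
  transverse : ∀ p ∈ singularSet g, mfderiv (𝓡 d) 𝓘(ℝ, ℝ) (gramDet g p) p ≠ 0
  regular : regularPart g ⊆ riemannianPart g ∪ lorentzianPart g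
  separates : singularSet g ⊆ closure (riemannianPart g) ∩ closure (lorentzianPart g)

/-- The radical is transverse to the hypersurface `Σ`, at every point of `Σ`. -/
def HasTransverseRadical (g : BilinField d M) : Prop :=
  ∀ p ∈ singularSet g, IsCompl (radical g p) (tangentSigma g p)

/-- The dual connection: `□_X Y (Z)` at `p`, given by the Koszul formula. -/
def dualConn (g : BilinField d M) (X Y Z : VField d M) (p : M) : ℝ :=
  (dirDeriv X (fun x => g x (Y x) (Z x)) p
    + dirDeriv Y (fun x => g x (Z x) (X x)) p
    - dirDeriv Z (fun x => g x (X x) (Y x)) p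
    + g p (VectorField.mlieBracket (𝓡 d) X Y p) (Z p)
    - g p (VectorField.mlieBracket (𝓡 d) Y Z p) (X p)
    + g p (VectorField.mlieBracket (𝓡 d) Z X p) (Y p)) / 2

open Classical in
/-- The Levi-Civita connection `∇_X Y` of `g`. At a point `p` where `g` is nondegenerate it is the
unique vector with `g(∇_X Y, Z) = □_X Y (Z)` for all `Z ∈ 𝔛(M)` (and it is not used elsewhere). -/
def nabla [IsManifold (𝓡 d) ∞ M] (g : BilinField d M) (X Y : VField d M) : VField d M := fun p =>
  if h : ∃ v : TangentSpace (𝓡 d) p,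
      ∀ Z : VField d M, IsSmoothVField Z → g p v (Z p) = dualConn g X Y Z p
  then h.choose else 0

/-- The curvature `R(X, Y)Z = ∇_X ∇_Y Z - ∇_Y ∇_X Z - ∇_[X,Y] Z`, at points where `g` is
nondegenerate. -/
def curvature [IsManifold (𝓡 d) ∞ M] (g : BilinField d M) (X Y Z : VField d M) : VField d M :=
  fun p => nabla g X (nabla g Y Z) p - nabla g Y (nabla g X Z) p
    - nabla g (VectorField.mlieBracket (𝓡 d) X Y) Z p

/-- The covariant curvature `K(X, Y, Z, T) = g(R(X, Y)Z, T)`. -/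
def covCurvature [IsManifold (𝓡 d) ∞ M] (g : BilinField d M) (X Y Z T : VField d M) (p : M) : ℝ :=
  g p (curvature g X Y Z p) (T p)

/-- `g` is flat on the set `U` (an open set of points where `g` is nondegenerate):
`K = 0` on `U`. -/
def IsFlatOn [IsManifold (𝓡 d) ∞ M] (g : BilinField d M) (U : Set M) : Prop :=
  ∀ X Y Z T : VField d M, IsSmoothVField X → IsSmoothVField Y → IsSmoothVField Z →
    IsSmoothVField T → ∀ p ∈ U, covCurvature g X Y Z T p = 0

/-- `R ∈ 𝔛(M)` is a radical vector field: `R_p ∈ Rad_p(M) ∖ {0}` for all `p ∈ Σ`. -/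
def IsRadicalVField [IsManifold (𝓡 d) ∞ M] (g : BilinField d M) (R : VField d M) : Prop :=
  IsSmoothVField R ∧ ∀ p ∈ singularSet g, R p ∈ radical g p ∧ R p ≠ 0

/-- `X ∈ 𝔛(M)` is tangent to `Σ`. -/
def IsTangentToSigma [IsManifold (𝓡 d) ∞ M] (g : BilinField d M) (X : VField d M) : Prop :=
  IsSmoothVField X ∧ ∀ p ∈ singularSet g, X p ∈ tangentSigma g p

/-- `II^R(X, Y) = □_X Y (R)`, at points `p ∈ Σ`, for `X` and `Y` in `𝔛(M)`. -/
def II (g : BilinField d M) (R X Y : VField d M) (p : M) : ℝ :=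
  dualConn g X Y R p

/-- `(M, g)` is `II`-flat: `II^R(X, Y) = 0` for all `X, Y` tangent to `Σ`, for some, and
equivalently for any, radical vector field `R`. -/
def IsIIFlat [IsManifold (𝓡 d) ∞ M] (g : BilinField d M) : Prop :=
  (∃ R, IsRadicalVField g R) ∧
    ∀ R, IsRadicalVField g R → ∀ X Y, IsTangentToSigma g X → IsTangentToSigma g Y →
      ∀ p ∈ singularSet g, II g R X Y p = 0

/-- `V ∈ 𝔛(M)` is a smooth extension of `∇_X Y`, from `𝕄` to `M`. -/
def IsNablaExtension [IsManifold (𝓡 d) ∞ M] (g : BilinField d M) (X Y V : VField d M) : Prop :=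
  IsSmoothVField V ∧ ∀ p ∈ regularPart g, V p = nabla g X Y p

/-- `(M, g)` is `III`-flat: it is `II`-flat and, for all `X, Y` tangent to `Σ`, the vector field
`∇_X Y` has a smooth extension `V` to `M`, and `III^R(X, Y) = II^R(V, R) = 0` on `Σ`, for some,
and equivalently for any, radical vector field `R`. -/
def IsIIIFlat [IsManifold (𝓡 d) ∞ M] (g : BilinField d M) : Prop :=
  IsIIFlat g ∧
    ∀ R, IsRadicalVField g R → ∀ X Y, IsTangentToSigma g X → IsTangentToSigma g Y →
      ∃ V, IsNablaExtension g X Y V ∧ ∀ p ∈ singularSet g, II g R V R p = 0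

end Basic

section Hypersurface

variable {n : ℕ} {M : Type*} [TopologicalSpace M]
  [ChartedSpace (EuclideanSpace ℝ (Fin (n + 1))) M]

/-- The smooth structure on `Σ` (with the subspace topology) for which `Σ` is an embedded
hypersurface of `M`. -/
def IsHypersurfaceStructure (g : BilinField (n + 1) M)
    (cs : ChartedSpace (EuclideanSpace ℝ (Fin n)) (singularSet g)) : Prop :=
  IsManifold (𝓡 n) ∞ (singularSet g) ∧
    Manifold.IsSmoothEmbedding (𝓡 n) (𝓡 (n + 1)) ∞ (Subtype.val : singularSet g → M)

/-- The induced metric `g_Σ`: the pullback of `g` under the inclusion of `Σ`. -/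
def inducedMetric (g : BilinField (n + 1) M)
    [ChartedSpace (EuclideanSpace ℝ (Fin n)) (singularSet g)] :
    BilinField n (singularSet g) := fun s =>
  let D := mfderiv (𝓡 n) (𝓡 (n + 1)) (Subtype.val : singularSet g → M) s
  ((ContinuousLinearMap.precomp ℝ D).comp (g s.1)).comp D

/-- `Σ` is flat: `Σ` is an embedded hypersurface of `M`, and the induced metric `g_Σ` is a
Riemannian metric with vanishing curvature. -/
def IsSigmaFlat (g : BilinField (n + 1) M) : Prop :=
  (∃ cs : ChartedSpace (EuclideanSpace ℝ (Fin n)) (singularSet g),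
      IsHypersurfaceStructure g cs) ∧
    ∀ (cs : ChartedSpace (EuclideanSpace ℝ (Fin n)) (singularSet g))
      (h : IsHypersurfaceStructure g cs),
      haveI : IsManifold (𝓡 n) ∞ (singularSet g) := h.1
      (∀ s, ∀ v : TangentSpace (𝓡 n) s, v ≠ 0 → 0 < inducedMetric g s v v) ∧
        IsFlatOn (inducedMetric g) Set.univ

end Hypersurface

end RiemannLorentz

end

open scoped Manifold ContDiff Topology

noncomputable section

namespace RiemannLorentz

open VectorField Bundle

/-! ### Integrals depending on a parameter, and division by a linear form. -/

section Analysis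

universe u

/-! Fix a radical field `R` and put f = g(R, R). On Σ the Gram determinant and f have proportional
differentials: there the adjugate of the Gram matrix has rank one and equals κ c ⊗ c, where c is the
coordinate vector of `R`. Points of Σ are limits of Riemannian points, so the Gram matrix is
positive semidefinite on Σ and κ > 0. Hence T Σ = ker df, and □_R R(R) = R f / 2 never vanishes on Σ
because the radical is transverse. The sign of d det on radical vectors makes the conditions on `R`
convex, so local radical fields glue to a global one.

Everything on 𝕄 passes to M by two devices: 𝕄 is dense, so identities between smooth quantities
extend; and by Cramer's rule with Hadamard's lemma ∇_X Y extends smoothly across Σ once □_X Y(R) = 0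
on Σ. For Y tangent to Σ, □_R Y(R) = □_Y R(R) = Y f / 2 = 0 on Σ, so ∇_R Y always extends.

II-flatness (`isIIFlat_of_isFlatOn`): for X, Z tangent, K(X, R, Z, R) = 0 expresses □_R R(∇_X Z)
through quantities smooth on all of M. By Cramer's rule det · □_R R(∇_X Z) is the pairing of □_X Z
with □_R R by the adjugate. On Σ the determinant vanishes and the adjugate is κ c ⊗ c, which leaves
κ · □_X Z(R) · □_R R(R) = 0, hence □_X Z(R) = 0.

III-flatness: II = 0 forces □_X R = 0 on Σ for X tangent (`dualConn_radical_right_eq_zero`), and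
then □_A Y(R) = 0 for Y tangent and A arbitrary (`dualConn_tangent_eq_zero`). Let V extend ∇_X Y. In
K(X, R, Y, R) = 0, continued to Σ, only □_R V(R) = V f / 2 survives, so V is tangent to Σ
(`IsNablaExtension.isTangentToSigma`). Since III^R(X, Y) = V f / 2 as well, this is III-flatness.

Flatness of Σ: tangency of V says that Σ is totally geodesic, so the Levi-Civita connection of g_Σ
is the restriction of the extended ∇, and the curvature of g_Σ is the restriction of the continued
K, which is zero. The comparison uses that fields on the closed set Σ extend to M and that the
Koszul formula is natural for related fields. -/

theorem hasFDerivAt_integral_unitInterval {E G : Type u} [NormedAddCommGroup E] [NormedSpace ℝ E]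
    [FiniteDimensional ℝ E] [NormedAddCommGroup G] [NormedSpace ℝ G] [CompleteSpace G]
    {f : E × ℝ → G} (hf : ContDiff ℝ 1 f) (x : E) :
    HasFDerivAt (fun x => ∫ t in (0 : ℝ)..1, f (x, t))
      (∫ t in (0 : ℝ)..1, (fderiv ℝ f (x, t)).comp (ContinuousLinearMap.inl ℝ E ℝ)) x := by
  have hc : Continuous fun q : E × ℝ =>
      (fderiv ℝ f q).comp (ContinuousLinearMap.inl ℝ E ℝ) :=
    (hf.continuous_fderiv one_ne_zero).clm_comp continuous_const
  obtain ⟨C, hC⟩ := ((isCompact_closedBall x 1).prod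
    (isCompact_Icc (a := (0 : ℝ)) (b := 1))).exists_bound_of_continuousOn
    hc.continuousOn
  refine intervalIntegral.hasFDerivAt_integral_of_dominated_of_fderiv_le
    (F := fun x t => f (x, t))
    (F' := fun x t => (fderiv ℝ f (x, t)).comp (ContinuousLinearMap.inl ℝ E ℝ))
    (bound := fun _ => C) (Metric.closedBall_mem_nhds x one_pos) ?_ ?_ ?_ ?_ ?_ ?_
  · exact Filter.Eventually.of_forall fun y =>
      (hf.continuous.comp (Continuous.prodMk_right y)).aestronglyMeasurable
  · exact (hf.continuous.comp (Continuous.prodMk_right x)).intervalIntegrable _ _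
  · exact (hc.comp (Continuous.prodMk_right x)).aestronglyMeasurable
  · refine Filter.Eventually.of_forall fun t ht y hy => hC (y, t) ⟨hy, ?_⟩
    rw [Set.uIoc_of_le zero_le_one] at ht
    exact ⟨ht.1.le, ht.2⟩
  · exact intervalIntegrable_const
  · refine Filter.Eventually.of_forall fun t _ y _ => ?_
    have h1 := (hf.differentiable one_ne_zero (y, t)).hasFDerivAt
    exact h1.comp y (hasFDerivAt_prodMk_left y t)

/-- The induction on the order lets the target space vary, since the derivative of the integrand
takes values in `E →L[ℝ] G`; this is why `E` and `G` share a universe. -/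
theorem contDiff_integral_unitInterval {E : Type u} [NormedAddCommGroup E] [NormedSpace ℝ E]
    [FiniteDimensional ℝ E] (n : ℕ) : ∀ {G : Type u} [NormedAddCommGroup G] [NormedSpace ℝ G]
    [CompleteSpace G] {f : E × ℝ → G}, ContDiff ℝ ∞ f →
    ContDiff ℝ n (fun x => ∫ t in (0 : ℝ)..1, f (x, t)) := by
  induction n with
  | zero =>
    intro G _ _ _ f hf
    rw [Nat.cast_zero, contDiff_zero]
    exact intervalIntegral.continuous_parametric_intervalIntegral_of_continuous'
      (f := fun x t => f (x, t)) hf.continuous 0 1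
  | succ n ih =>
    intro G _ _ _ f hf
    rw [show ((n + 1 : ℕ) : WithTop ℕ∞) = (n : WithTop ℕ∞) + 1 by norm_cast,
      contDiff_succ_iff_hasFDerivAt]
    refine ⟨_, ih (f := fun q => (fderiv ℝ f q).comp (ContinuousLinearMap.inl ℝ E ℝ)) ?_,
      fun x => hasFDerivAt_integral_unitInterval (hf.of_le (by exact_mod_cast le_top)) x⟩
    exact (hf.fderiv_right (m := ∞) (by simp)).clm_comp contDiff_const

/-- Hadamard's lemma for a linear form. -/
theorem exists_contDiff_eq_linear_mul {E : Type} [NormedAddCommGroup E] [NormedSpace ℝ E]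
    [FiniteDimensional ℝ E] (ℓ : E →L[ℝ] ℝ) (hℓ : ℓ ≠ 0) {F : E → ℝ} (hF : ContDiff ℝ ∞ F)
    (h0 : ∀ z, ℓ z = 0 → F z = 0) :
    ∃ h : E → ℝ, ContDiff ℝ ∞ h ∧ ∀ z, F z = ℓ z * h z := by
  obtain ⟨e, he⟩ : ∃ e, ℓ e = 1 := by
    obtain ⟨v, hv⟩ := DFunLike.ne_iff.1 hℓ
    exact ⟨(ℓ v)⁻¹ • v, by simp at hv; simp [hv]⟩
  -- The segment runs in direction `e` from the projection of z to ker ℓ, where `F` vanishes, to z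
  -- itself. Its velocity is ℓ(z) e, which produces the factor ℓ(z).
  let c : E × ℝ → E := fun q => q.1 - ℓ q.1 • e + (q.2 * ℓ q.1) • e
  have hc : ContDiff ℝ ∞ c := by fun_prop
  refine ⟨fun z => ∫ t in (0 : ℝ)..1, fderiv ℝ F (c (z, t)) e,
    contDiff_infty.2 fun n => contDiff_integral_unitInterval n
      (f := fun q => fderiv ℝ F (c q) e) ?_, fun z => ?_⟩
  · exact (((hF.fderiv_right (m := ∞) (by simp)).comp hc)).clm_apply contDiff_const
  · have hd : ∀ t : ℝ, HasDerivAt (fun t => F (c (z, t))) (ℓ z * fderiv ℝ F (c (z, t)) e) t := by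
      intro t
      have h1 : HasDerivAt (fun t => c (z, t)) (ℓ z • e) t := by
        have := (((hasDerivAt_id t).mul_const (ℓ z)).smul_const e).const_add (z - ℓ z • e)
        simpa [c] using this
      have h2 := (hF.differentiable (by simp) (c (z, t))).hasFDerivAt.comp_hasDerivAt t h1
      simpa using! h2
    have hcont : Continuous fun t : ℝ => ℓ z * fderiv ℝ F (c (z, t)) e := by
      have := (hF.continuous_fderiv (by simp)).comp (hc.continuous.comp (Continuous.prodMk_right z))
      exact continuous_const.mul (this.clm_apply continuous_const)
    have h3 := intervalIntegral.integral_eq_sub_of_hasDerivAt (a := 0) (b := 1)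
      (fun t _ => hd t) (hcont.intervalIntegrable _ _)
    rw [intervalIntegral.integral_const_mul] at h3
    rw [h3, h0 (c (z, 0)) (by simp [c, he])]
    simp [c]

end Analysis

/-- Straightening of a function with nonzero differential, in a normed space. -/
theorem exists_openPartialHomeomorph_straightening {E : Type} [NormedAddCommGroup E]
    [NormedSpace ℝ E] [CompleteSpace E] {τ : E → ℝ} {U : Set E} (hU : IsOpen U) {y₀ : E}
    (hy₀ : y₀ ∈ U) (hτ : ContDiffOn ℝ ∞ τ U) (h0 : fderiv ℝ τ y₀ ≠ 0) :
    ∃ Φ : OpenPartialHomeomorph E E, y₀ ∈ Φ.source ∧ Φ.source ⊆ U ∧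
      ContDiffOn ℝ ∞ Φ Φ.source ∧ ContDiffOn ℝ ∞ Φ.symm Φ.target ∧
      ∀ y ∈ Φ.source, fderiv ℝ τ y₀ (Φ y) = τ y := by
  set ℓ := fderiv ℝ τ y₀ with hℓ
  obtain ⟨e, he⟩ : ∃ e, ℓ e = 1 := by
    obtain ⟨v, hv⟩ := DFunLike.ne_iff.1 h0
    exact ⟨(ℓ v)⁻¹ • v, by simp at hv; simp [hv]⟩
  have hτat : ∀ y ∈ U, ContDiffAt ℝ ∞ τ y := fun y hy => hτ.contDiffAt (hU.mem_nhds hy)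
  -- Correcting the identity along `e`, with ℓ(e) = 1, gives ℓ ∘ φ = τ exactly, and the derivative
  -- at `y₀` is the identity.
  let φ : E → E := fun y => y + (τ y - ℓ y) • e
  have hφat : ∀ y ∈ U, ContDiffAt ℝ ∞ φ y := fun y hy =>
    contDiffAt_id.add (((hτat y hy).sub ℓ.contDiff.contDiffAt).smul contDiffAt_const)
  have hφd : ∀ y ∈ U, HasFDerivAt φ
      (ContinuousLinearMap.id ℝ E + (fderiv ℝ τ y - ℓ).smulRight e) y := fun y hy =>
    (hasFDerivAt_id y).add ((((hτat y hy).differentiableAt (by simp)).hasFDerivAt.sub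
      ℓ.hasFDerivAt).smul_const e)
  have hφ0 : HasFDerivAt φ ((ContinuousLinearEquiv.refl ℝ E : E ≃L[ℝ] E) : E →L[ℝ] E) y₀ := by
    convert! hφd y₀ hy₀ using 1
    simp [← hℓ]
  let Φ := (hφat y₀ hy₀).toOpenPartialHomeomorph φ hφ0 (by simp)
  have hΦ : ∀ y, Φ y = φ y := fun y => by
    exact congrFun ((hφat y₀ hy₀).toOpenPartialHomeomorph_coe hφ0 (by simp)) y
  have hder : ContinuousOn (fun y => ContinuousLinearMap.id ℝ E + (fderiv ℝ τ y - ℓ).smulRight e)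
      U := by
    have h1 : ContinuousOn (fderiv ℝ τ) U := hτ.continuousOn_fderiv_of_isOpen hU (by simp)
    have h2 : Continuous fun A : E →L[ℝ] ℝ => A.smulRight e :=
      ((ContinuousLinearMap.smulRightL ℝ E E).flip e).continuous
    exact continuousOn_const.add (h2.comp_continuousOn (h1.sub continuousOn_const))
  -- The inverse function theorem gives smoothness of the inverse at one point only; restricting to
  -- the open set where the derivative is invertible makes the inverse smooth on the whole target.
  let V := U ∩ (fun y => ContinuousLinearMap.id ℝ E + (fderiv ℝ τ y - ℓ).smulRight e) ⁻¹'
    Set.range ((↑) : (E ≃L[ℝ] E) → E →L[ℝ] E)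
  have hV : IsOpen V := hder.isOpen_inter_preimage hU ContinuousLinearEquiv.isOpen
  have hyV : y₀ ∈ V := ⟨hy₀, ContinuousLinearEquiv.refl ℝ E, by simp [← hℓ]⟩
  refine ⟨Φ.restrOpen V hV, ⟨(hφat y₀ hy₀).mem_toOpenPartialHomeomorph_source hφ0 (by simp), hyV⟩,
    fun y hy => hy.2.1, fun y hy => ?_, fun z hz => ?_, fun y hy => ?_⟩
  · refine (((hφat y hy.2.1)).congr_of_eventuallyEq
      (Filter.Eventually.of_forall fun y => ?_)).contDiffWithinAt
    exact hΦ y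
  · have hz' : Φ.symm z ∈ V := by
      have := (Φ.restrOpen V hV).map_target hz
      exact this.2
    obtain ⟨A, hA⟩ := hz'.2
    have hzt : z ∈ Φ.target := by
      have := hz
      simp at this
      exact this.1
    have hd := hφd _ hz'.1
    refine (Φ.contDiffAt_symm (f₀' := A) hzt ?_ ?_).contDiffWithinAt
    · have h3 : (A : E →L[ℝ] E) = _ := hA
      rw [h3]
      exact hd.congr_of_eventuallyEq (Filter.Eventually.of_forall hΦ)
    · exact (hφat _ hz'.1).congr_of_eventuallyEq (Filter.Eventually.of_forall hΦ)
  · change ℓ (Φ y) = τ y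
    rw [hΦ]
    simp [φ, he]

/-! ### Adapted charts, extension of germs, and Hadamard's lemma on a manifold. -/

section Manifold

variable {d : ℕ} {M : Type*} [TopologicalSpace M] [ChartedSpace (EuclideanSpace ℝ (Fin d)) M]
  [IsManifold (𝓡 d) ∞ M]

/-- Around a point where its differential does not vanish, a smooth function is linear in a
suitable chart. -/
theorem exists_chart_eq_linear {D : M → ℝ} (hD : ContMDiff (𝓡 d) 𝓘(ℝ, ℝ) ∞ D) {p : M}
    (hp : mfderiv (𝓡 d) 𝓘(ℝ, ℝ) D p ≠ 0) :
    ∃ ψ ∈ IsManifold.maximalAtlas (𝓡 d) ∞ M, p ∈ ψ.source ∧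
      ∃ ℓ : EuclideanSpace ℝ (Fin d) →L[ℝ] ℝ, ℓ ≠ 0 ∧ ∀ x ∈ ψ.source, ℓ (ψ x) = D x := by
  let c := chartAt (EuclideanSpace ℝ (Fin d)) p
  let τ : EuclideanSpace ℝ (Fin d) → ℝ := D ∘ c.symm
  have hτ : ContDiffOn ℝ ∞ τ c.target := by
    rw [← contMDiffOn_iff_contDiffOn]
    exact hD.comp_contMDiffOn (contMDiffOn_chart_symm (I := 𝓡 d))
  have hder : fderiv ℝ τ (c p) ≠ 0 := by
    intro h
    apply hp
    rw [(hD.mdifferentiable (by simp) p).mfderiv]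
    simpa [writtenInExtChartAt, τ, c, fderivWithin_univ, Function.comp_def] using! h
  obtain ⟨Φ, h1, h2, h3, h4, h5⟩ := exists_openPartialHomeomorph_straightening c.open_target
    (mem_chart_target _ p) hτ hder
  refine ⟨c.trans Φ, ?_, ?_, fderiv ℝ τ (c p), hder, fun x hx => ?_⟩
  · refine OpenPartialHomeomorph.mem_maximalAtlas_of_contMDiffOn _ ?_ ?_
    · rw [OpenPartialHomeomorph.coe_trans]
      refine ContMDiffOn.comp (t := Φ.source) (I' := 𝓡 d) (contMDiffOn_iff_contDiffOn.2 h3)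
        ((contMDiffOn_chart (I := 𝓡 d)).mono ?_) ?_
      · intro x hx; rw [OpenPartialHomeomorph.trans_source] at hx; exact hx.1
      · intro x hx; rw [OpenPartialHomeomorph.trans_source] at hx; exact hx.2
    · rw [OpenPartialHomeomorph.coe_trans_symm]
      refine ContMDiffOn.comp (t := c.target) (I' := 𝓡 d) (contMDiffOn_chart_symm (I := 𝓡 d))
        ((contMDiffOn_iff_contDiffOn.2 h4).mono ?_) ?_
      · intro x hx; rw [OpenPartialHomeomorph.trans_target] at hx; exact hx.1
      · intro x hx; rw [OpenPartialHomeomorph.trans_target] at hx; exact hx.2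
  · rw [OpenPartialHomeomorph.trans_source]
    exact ⟨mem_chart_source _ p, h1⟩
  · rw [OpenPartialHomeomorph.trans_source] at hx
    rw [OpenPartialHomeomorph.coe_trans, Function.comp_apply, h5 _ hx.2]
    simp only [τ, Function.comp_apply]
    rw [c.left_inv hx.1]

variable [T2Space M] [SecondCountableTopology M]

/-- A partition of unity selects smoothly from convex sets: the singleton of the prescribed value on
a closed neighbourhood, no condition outside it. This turns germs into global objects, so that later
arguments use only global smooth functions and fields. -/
theorem exists_contMDiff_eventuallyEq {F : Type*} [NormedAddCommGroup F] [NormedSpace ℝ F]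
    {f : M → F} {p : M} (hf : ∀ᶠ x in 𝓝 p, ContMDiffAt (𝓡 d) 𝓘(ℝ, F) ∞ f x) :
    ∃ F' : M → F, ContMDiff (𝓡 d) 𝓘(ℝ, F) ∞ F' ∧ F' =ᶠ[𝓝 p] f := by
  have : LocallyCompactSpace M := Manifold.locallyCompact_of_finiteDimensional (𝓡 d)
  obtain ⟨U, hU, hUo, hpU⟩ := eventually_nhds_iff.1 hf
  obtain ⟨K, hK, hKc, hKU⟩ := exists_mem_nhds_isClosed_subset (hUo.mem_nhds hpU)
  classical
  obtain ⟨s, hs⟩ := exists_contMDiffMap_forall_mem_convex_of_local (𝓡 d) (n := (⊤ : ℕ∞)) (M := M)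
    (t := fun x => if x ∈ K then {f x} else Set.univ)
    (fun x => by split_ifs; exacts [convex_singleton _, convex_univ]) (fun x => by
      by_cases hx : x ∈ K
      · refine ⟨U, hUo.mem_nhds (hKU hx), f, fun y hy => (hU y hy).contMDiffWithinAt, ?_⟩
        intro y _; split_ifs <;> simp
      · refine ⟨Kᶜ, hKc.isOpen_compl.mem_nhds hx, 0, contMDiffOn_const, ?_⟩
        intro y hy
        rw [if_neg hy]
        trivial)
  refine ⟨s, s.contMDiff, ?_⟩
  filter_upwards [hK] with x hx
  have := hs x
  rw [if_pos hx] at this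
  exact this

/-- A vector field on `M` with values in given convex sets exists if it exists locally. -/
theorem exists_isSmoothVField_forall_mem (t : ∀ x : M, Set (TangentSpace (𝓡 d) x))
    (ht : ∀ x, Convex ℝ (t x))
    (H : ∀ x₀ : M, ∃ V : VField d M, IsSmoothVField V ∧ ∀ᶠ x in 𝓝 x₀, V x ∈ t x) :
    ∃ V : VField d M, IsSmoothVField V ∧ ∀ x, V x ∈ t x := by
  have : LocallyCompactSpace M := Manifold.locallyCompact_of_finiteDimensional (𝓡 d)
  obtain ⟨s, hs⟩ := exists_contMDiffSection_forall_mem_convex_of_local (𝓡 d) (n := (⊤ : ℕ∞))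
    (fun x : M => TangentSpace (𝓡 d) x) t ht (fun x => by
      obtain ⟨V, hV, h⟩ := H x
      exact ⟨_, h, V, hV.contMDiffOn, fun y hy => hy⟩)
  exact ⟨s, s.contMDiff, hs⟩

theorem exists_isSmoothVField_eventuallyEq {V : VField d M} {p : M}
    (hV : ∀ᶠ x in 𝓝 p, ContMDiffAt (𝓡 d) (𝓡 d).tangent ∞
      (fun x => (Bundle.TotalSpace.mk' (EuclideanSpace ℝ (Fin d)) x (V x) :
      TangentBundle (𝓡 d) M)) x) :
    ∃ W : VField d M, IsSmoothVField W ∧ W =ᶠ[𝓝 p] V := by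
  have : LocallyCompactSpace M := Manifold.locallyCompact_of_finiteDimensional (𝓡 d)
  obtain ⟨U, hU, hUo, hpU⟩ := eventually_nhds_iff.1 hV
  obtain ⟨K, hK, hKc, hKU⟩ := exists_mem_nhds_isClosed_subset (hUo.mem_nhds hpU)
  classical
  obtain ⟨s, hs⟩ := exists_contMDiffSection_forall_mem_convex_of_local (𝓡 d) (n := (⊤ : ℕ∞))
    (fun x : M => TangentSpace (𝓡 d) x)
    (t := fun x => if x ∈ K then {V x} else Set.univ)
    (fun x => by split_ifs; exacts [convex_singleton _, convex_univ]) (fun x => by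
      by_cases hx : x ∈ K
      · refine ⟨U, hUo.mem_nhds (hKU hx), V, fun y hy => (hU y hy).contMDiffWithinAt, ?_⟩
        intro y _; split_ifs <;> simp
      · refine ⟨Kᶜ, hKc.isOpen_compl.mem_nhds hx, fun _ => 0,
          (Bundle.contMDiff_zeroSection ℝ _).contMDiffOn, ?_⟩
        intro y hy
        rw [if_neg hy]
        trivial)
  refine ⟨s, s.contMDiff, ?_⟩
  filter_upwards [hK] with x hx
  have := hs x
  rw [if_pos hx] at this
  exact this

/-- Hadamard's lemma: a smooth function vanishing on the zero set of `D` is divisible by `D`, near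
a point where `D` is either nonzero or has nonzero differential. -/
theorem exists_contMDiff_eq_mul {D f : M → ℝ} (hD : ContMDiff (𝓡 d) 𝓘(ℝ, ℝ) ∞ D)
    (hf : ContMDiff (𝓡 d) 𝓘(ℝ, ℝ) ∞ f) {p : M}
    (hp : D p ≠ 0 ∨ mfderiv (𝓡 d) 𝓘(ℝ, ℝ) D p ≠ 0) (h0 : ∀ᶠ x in 𝓝 p, D x = 0 → f x = 0) :
    ∃ h : M → ℝ, ContMDiff (𝓡 d) 𝓘(ℝ, ℝ) ∞ h ∧ ∀ᶠ x in 𝓝 p, f x = D x * h x := by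
  rcases hp with hp | hp
  · have hne : ∀ᶠ x in 𝓝 p, D x ≠ 0 := hD.continuous.continuousAt.eventually_ne hp
    obtain ⟨h, hh, he⟩ := exists_contMDiff_eventuallyEq (f := fun x => f x / D x) (p := p)
      (hne.mono fun x hx => (hf x).div₀ (hD x) hx)
    refine ⟨h, hh, ?_⟩
    filter_upwards [he, hne] with x h1 h2
    rw [h1]; field_simp
  · obtain ⟨ψ, hψ, hpψ, ℓ, hℓ, hlin⟩ := exists_chart_eq_linear hD hp
    obtain ⟨W, hW, hWo, hpW⟩ := eventually_nhds_iff.1 h0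
    have hsm : ContMDiffOn (𝓡 d) 𝓘(ℝ, ℝ) ∞ (f ∘ ψ.symm) ψ.target :=
      hf.comp_contMDiffOn (contMDiffOn_symm_of_mem_maximalAtlas hψ)
    let N := ψ.target ∩ ψ.symm ⁻¹' W
    have hN : IsOpen N := ψ.isOpen_inter_preimage_symm hWo
    have hpN : ψ p ∈ N := ⟨ψ.map_source hpψ, by simpa [ψ.left_inv hpψ] using hpW⟩
    obtain ⟨b, hb⟩ : ∃ b : ContDiffBump (ψ p), Metric.closedBall (ψ p) b.rOut ⊆ N := by
      obtain ⟨ε, hε, h⟩ := Metric.isOpen_iff.1 hN _ hpN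
      exact ⟨⟨ε / 4, ε / 2, by positivity, by linarith⟩,
        (Metric.closedBall_subset_ball (by simp; linarith)).trans h⟩
    -- The bump function makes `f` in the chart a globally defined smooth function without spoiling
    -- its vanishing on ker ℓ, as division by ℓ requires; near p the bump equals 1.
    have hFs : ContDiff ℝ ∞ fun z => b z * (f ∘ ψ.symm) z := by
      rw [contDiff_iff_contDiffAt]
      intro z
      by_cases hz : z ∈ N
      · have h1 : ContDiffAt ℝ ∞ (f ∘ ψ.symm) z :=
          (contMDiffOn_iff_contDiffOn.1 hsm).contDiffAt (ψ.open_target.mem_nhds hz.1)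
        exact b.contDiffAt.mul h1
      · have hz' : z ∉ tsupport b := fun h => hz (hb (b.tsupport_eq ▸ h))
        have h2 : (fun z => b z * (f ∘ ψ.symm) z) =ᶠ[𝓝 z] fun _ => 0 := by
          filter_upwards [notMem_tsupport_iff_eventuallyEq.1 hz'] with y hy
          rw [hy]; simp
        exact contDiffAt_const.congr_of_eventuallyEq h2
    obtain ⟨h, hh, hmul⟩ := exists_contDiff_eq_linear_mul ℓ hℓ hFs (fun z hz => by
      by_cases hzN : z ∈ N
      · have h3 : D (ψ.symm z) = 0 := by
          rw [← hlin _ (ψ.map_target hzN.1), ψ.right_inv hzN.1, hz]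
        have h4 := hW _ hzN.2 h3
        simp [h4]
      · have hz' : z ∉ tsupport b := fun h => hzN (hb (b.tsupport_eq ▸ h))
        rw [image_eq_zero_of_notMem_tsupport hz', zero_mul])
    have hcomp : ∀ᶠ x in 𝓝 p, ContMDiffAt (𝓡 d) 𝓘(ℝ, ℝ) ∞ (h ∘ ψ) x := by
      filter_upwards [ψ.open_source.mem_nhds hpψ] with x hx
      exact hh.contMDiff.contMDiffAt.comp x (contMDiffAt_of_mem_maximalAtlas hψ hx)
    obtain ⟨k, hk, hke⟩ := exists_contMDiff_eventuallyEq hcomp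
    refine ⟨k, hk, ?_⟩
    have hb1 : ∀ᶠ x in 𝓝 p, b (ψ x) = 1 :=
      (ψ.continuousAt hpψ).eventually b.eventuallyEq_one
    filter_upwards [hke, ψ.open_source.mem_nhds hpψ, hb1] with x h1 h2 h3
    have h4 := hmul (ψ x)
    rw [h3, Function.comp_apply, ψ.left_inv h2, hlin x h2, one_mul] at h4
    rw [h4, h1]; rfl

end Manifold

/-! ### Derivatives along fields, and smoothness of the basic operations. -/

section Calculus

variable {d : ℕ} {M : Type*} [TopologicalSpace M] [ChartedSpace (EuclideanSpace ℝ (Fin d)) M]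

theorem dirDeriv_eq_mvfderiv (X : VField d M) (f : M → ℝ) (p : M) :
    dirDeriv X f p = mvfderiv (𝓡 d) f p (X p) := rfl

variable {X Y Z T : VField d M} {f h : M → ℝ} {p : M} {g : BilinField d M}

theorem dirDeriv_add (hf : MDifferentiableAt (𝓡 d) 𝓘(ℝ, ℝ) f p)
    (hh : MDifferentiableAt (𝓡 d) 𝓘(ℝ, ℝ) h p) :
    dirDeriv X (fun x => f x + h x) p = dirDeriv X f p + dirDeriv X h p := by
  simp only [dirDeriv_eq_mvfderiv]
  exact DFunLike.congr_fun (mvfderiv_add hf hh) (X p)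

theorem dirDeriv_mul (hf : MDifferentiableAt (𝓡 d) 𝓘(ℝ, ℝ) f p)
    (hh : MDifferentiableAt (𝓡 d) 𝓘(ℝ, ℝ) h p) :
    dirDeriv X (fun x => f x * h x) p = f p * dirDeriv X h p + h p * dirDeriv X f p := by
  simp only [dirDeriv_eq_mvfderiv]
  have := DFunLike.congr_fun (mvfderiv_mul hf hh) (X p)
  simpa using! this

theorem dirDeriv_sum {ι : Type*} {s : Finset ι} {F : ι → M → ℝ}
    (hF : ∀ i ∈ s, MDifferentiableAt (𝓡 d) 𝓘(ℝ, ℝ) (F i) p) :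
    dirDeriv X (fun x => ∑ i ∈ s, F i x) p = ∑ i ∈ s, dirDeriv X (F i) p := by
  classical
  suffices h : MDifferentiableAt (𝓡 d) 𝓘(ℝ, ℝ) (fun x => ∑ i ∈ s, F i x) p ∧
      dirDeriv X (fun x => ∑ i ∈ s, F i x) p = ∑ i ∈ s, dirDeriv X (F i) p from h.2
  induction s using Finset.induction_on with
  | empty =>
    simp only [Finset.sum_empty]
    refine ⟨mdifferentiableAt_const, ?_⟩
    rw [dirDeriv_eq_mvfderiv, mvfderiv_const]; rfl
  | insert a s ha ih =>
    obtain ⟨h1, h2⟩ := ih fun i hi => hF i (Finset.mem_insert_of_mem hi)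
    have h3 := hF a (Finset.mem_insert_self _ _)
    simp only [Finset.sum_insert ha]
    exact ⟨h3.add h1, by rw [dirDeriv_add h3 h1, h2]⟩

theorem dirDeriv_congr (hfh : f =ᶠ[𝓝 p] h) : dirDeriv X f p = dirDeriv X h p := by
  simp only [dirDeriv, hfh.mfderiv_eq]
  rfl

theorem dirDeriv_congr_field (hXY : X p = Y p) : dirDeriv X f p = dirDeriv Y f p := by
  simp only [dirDeriv, hXY]; rfl

theorem dirDeriv_field_add : dirDeriv (X + Y) f p = dirDeriv X f p + dirDeriv Y f p :=
  (mvfderiv (𝓡 d) f p).map_add (X p) (Y p)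

theorem dirDeriv_field_smul : dirDeriv (h • X) f p = h p * dirDeriv X f p :=
  (mvfderiv (𝓡 d) f p).map_smul (h p) (X p)

variable [IsManifold (𝓡 d) ∞ M]

theorem IsSmoothVField.mdifferentiableAt (hX : IsSmoothVField X) (p : M) :
    MDifferentiableAt (𝓡 d) (𝓡 d).tangent
      (fun x => (TotalSpace.mk' (EuclideanSpace ℝ (Fin d)) x (X x) :
      TangentBundle (𝓡 d) M)) p :=
  ContMDiff.mdifferentiableAt hX (by simp)

theorem IsSmoothVField.add (hX : IsSmoothVField X) (hY : IsSmoothVField Y) :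
    IsSmoothVField (X + Y) := hX.add_section hY

theorem IsSmoothVField.smul (hf : ContMDiff (𝓡 d) 𝓘(ℝ, ℝ) ∞ f) (hX : IsSmoothVField X) :
    IsSmoothVField (f • X) := hf.smul_section hX

theorem IsSmoothVField.const_smul (c : ℝ) (hX : IsSmoothVField X) :
    IsSmoothVField (c • X) := hX.const_smul_section

theorem IsSmoothVField.sum {ι : Type*} {s : Finset ι} {V : ι → VField d M}
    (hV : ∀ i, IsSmoothVField (V i)) :
    IsSmoothVField (fun x => ∑ i ∈ s, V i x) := ContMDiff.sum_section fun i _ => hV i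

theorem IsSmoothVField.mlieBracket (hX : IsSmoothVField X) (hY : IsSmoothVField Y) :
    IsSmoothVField (mlieBracket (𝓡 d) X Y) := by
  have : IsManifold (𝓡 d) (((⊤ : ℕ∞) : WithTop ℕ∞) + 1) M := by
    simpa using! (inferInstance : IsManifold (𝓡 d) ∞ M)
  have : IsManifold (𝓡 d) (minSmoothness ℝ 2) M := by
    simpa using! IsManifold.of_le (I := 𝓡 d) (M := M) (m := 2) (n := ∞)
      (WithTop.coe_le_coe.2 (le_top : (2 : ℕ∞) ≤ ⊤))
  exact fun x => ContMDiffAt.mlieBracket_vectorField (n := ⊤) (m := ⊤) (hX x) (hY x) (by simp)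

theorem IsSmoothBilinField.contMDiff_apply (hg : IsSmoothBilinField g) (hX : IsSmoothVField X)
    (hY : IsSmoothVField Y) : ContMDiff (𝓡 d) 𝓘(ℝ, ℝ) ∞ fun x => g x (X x) (Y x) := by
  have := ContMDiff.clm_bundle_apply₂ (F₁ := EuclideanSpace ℝ (Fin d))
    (F₂ := EuclideanSpace ℝ (Fin d)) (F₃ := ℝ) (E₃ := Bundle.Trivial M ℝ)  hg hX hY
  intro x
  have h2 := this x
  rw [Bundle.contMDiffAt_section] at h2
  exact h2

theorem IsSmoothBilinField.mdifferentiableAt_apply (hg : IsSmoothBilinField g)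
    (hX : MDifferentiableAt (𝓡 d) (𝓡 d).tangent
      (fun x => (TotalSpace.mk' (EuclideanSpace ℝ (Fin d)) x (X x) :
      TangentBundle (𝓡 d) M)) p)
    (hY : MDifferentiableAt (𝓡 d) (𝓡 d).tangent
      (fun x => (TotalSpace.mk' (EuclideanSpace ℝ (Fin d)) x (Y x) :
      TangentBundle (𝓡 d) M)) p) :
    MDifferentiableAt (𝓡 d) 𝓘(ℝ, ℝ) (fun x => g x (X x) (Y x)) p := by
  have := MDifferentiableAt.clm_bundle_apply₂ (F₁ := EuclideanSpace ℝ (Fin d))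
    (F₂ := EuclideanSpace ℝ (Fin d)) (F₃ := ℝ) (E₃ := Bundle.Trivial M ℝ)
    (ContMDiffAt.mdifferentiableAt (hg p) (by simp)) hX hY
  rw [mdifferentiableAt_totalSpace] at this
  exact this.2

theorem contMDiff_dirDeriv (hX : IsSmoothVField X) (hf : ContMDiff (𝓡 d) 𝓘(ℝ, ℝ) ∞ f) :
    ContMDiff (𝓡 d) 𝓘(ℝ, ℝ) ∞ (dirDeriv X f) := by
  have h1 : ContMDiff (𝓡 d) 𝓘(ℝ, ℝ).tangent ∞
      (fun x => tangentMap (𝓡 d) 𝓘(ℝ, ℝ) f (TotalSpace.mk' (EuclideanSpace ℝ (Fin d)) x (X x))) :=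
    (hf.contMDiff_tangentMap (m := ∞) (by simp)).comp hX
  intro x
  have h2 := (contMDiffAt_totalSpace.1 (h1 x)).2
  simpa using! h2

end Calculus

/-! ### The dual connection: metric compatibility, absence of torsion, tensoriality. -/

section DualConnection

variable {d : ℕ} {M : Type*} [TopologicalSpace M] [ChartedSpace (EuclideanSpace ℝ (Fin d)) M]
  {g : BilinField d M} {X Y Z T X' Y' Z' : VField d M} {p : M}

/-- Metric compatibility in dual form. The Koszul terms cancel by symmetry of g and antisymmetry of
the bracket alone, so it holds at degenerate points and without differentiability. -/
theorem dualConn_add_swap (hs : ∀ (p : M) (v w : TangentSpace (𝓡 d) p), g p v w = g p w v) :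
    dualConn g X Y Z p + dualConn g X Z Y p = dirDeriv X (fun x => g x (Y x) (Z x)) p := by
  simp only [dualConn, mlieBracket_swap_apply (V := Y) (W := X),
    mlieBracket_swap_apply (V := Z) (W := Y), mlieBracket_swap_apply (V := Z) (W := X)]
  simp only [hs _ (Z _) (Y _), hs _ (Z _) (X _), hs _ (Y _) (X _), map_neg,
    neg_apply]
  ring

theorem dualConn_self_right (hs : ∀ (p : M) (v w : TangentSpace (𝓡 d) p), g p v w = g p w v) :
    dualConn g X Y Y p = dirDeriv X (fun x => g x (Y x) (Y x)) p / 2 := by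
  linarith [dualConn_add_swap (X := X) (Y := Y) (Z := Y) (p := p) hs]

/-- The dual form of vanishing torsion, again a formal cancellation. -/
theorem dualConn_sub_swap (hs : ∀ (p : M) (v w : TangentSpace (𝓡 d) p), g p v w = g p w v) :
    dualConn g X Y Z p - dualConn g Y X Z p = g p (mlieBracket (𝓡 d) X Y p) (Z p) := by
  simp only [dualConn, mlieBracket_swap_apply (V := Y) (W := X),
    mlieBracket_swap_apply (V := Z) (W := Y), mlieBracket_swap_apply (V := Z) (W := X)]
  simp only [hs _ (Z _) (Y _), hs _ (Z _) (X _), hs _ (Y _) (X _), map_neg,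
    neg_apply]
  ring

theorem dualConn_congr (hX : X =ᶠ[𝓝 p] X') (hY : Y =ᶠ[𝓝 p] Y') (hZ : Z =ᶠ[𝓝 p] Z') :
    dualConn g X Y Z p = dualConn g X' Y' Z' p := by
  simp only [dualConn]
  rw [hX.mlieBracket_vectorField_eq hY, hY.mlieBracket_vectorField_eq hZ,
    hZ.mlieBracket_vectorField_eq hX, hX.self_of_nhds, hY.self_of_nhds, hZ.self_of_nhds,
    dirDeriv_congr_field hX.self_of_nhds, dirDeriv_congr_field hY.self_of_nhds,
    dirDeriv_congr_field hZ.self_of_nhds,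
    dirDeriv_congr (f := fun x => g x (Y x) (Z x)) (h := fun x => g x (Y' x) (Z' x))
      (by filter_upwards [hY, hZ] with x h1 h2; rw [h1, h2]),
    dirDeriv_congr (f := fun x => g x (Z x) (X x)) (h := fun x => g x (Z' x) (X' x))
      (by filter_upwards [hZ, hX] with x h1 h2; rw [h1, h2]),
    dirDeriv_congr (f := fun x => g x (X x) (Y x)) (h := fun x => g x (X' x) (Y' x))
      (by filter_upwards [hX, hY] with x h1 h2; rw [h1, h2])]

variable [IsManifold (𝓡 d) ∞ M]

theorem contMDiff_dualConn (hg : IsSmoothBilinField g) (hX : IsSmoothVField X)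
    (hY : IsSmoothVField Y) (hZ : IsSmoothVField Z) :
    ContMDiff (𝓡 d) 𝓘(ℝ, ℝ) ∞ (dualConn g X Y Z) := by
  have h1 := contMDiff_dirDeriv hX (hg.contMDiff_apply hY hZ)
  have h2 := contMDiff_dirDeriv hY (hg.contMDiff_apply hZ hX)
  have h3 := contMDiff_dirDeriv hZ (hg.contMDiff_apply hX hY)
  have h4 := hg.contMDiff_apply (hX.mlieBracket hY) hZ
  have h5 := hg.contMDiff_apply (hY.mlieBracket hZ) hX
  have h6 := hg.contMDiff_apply (hZ.mlieBracket hX) hY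
  exact (((((h1.add h2).sub h3).add h4).sub h5).add h6).div_const 2

/-- When Z is multiplied by f, the Leibniz terms (X f) g(Y, Z) and (Y f) g(Z, X) cancel against
those of the brackets [f Z, X] and [Y, f Z]. Thus □_X Y at p is a covector, also on Σ. -/
theorem tensorialAt_dualConn_right (hg : IsSmoothBilinField g)
    (hs : ∀ (p : M) (v w : TangentSpace (𝓡 d) p), g p v w = g p w v)
    (hX : IsSmoothVField X) (hY : IsSmoothVField Y) :
    TensorialAt (𝓡 d) (EuclideanSpace ℝ (Fin d)) (fun Z : VField d M => dualConn g X Y Z p) p where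
  smul {f Z} hf hZ := by
    have hX := hX.mdifferentiableAt p
    have hY := hY.mdifferentiableAt p
    have h1 := dirDeriv_mul (X := X) hf (hg.mdifferentiableAt_apply hY hZ)
    have h2 := dirDeriv_mul (X := Y) hf (hg.mdifferentiableAt_apply hZ hX)
    simp only [dualConn, Pi.smul_apply', map_smul, smul_eq_mul, smul_apply,
      dirDeriv_field_smul, h1, h2, mlieBracket_smul_right hf hZ, mlieBracket_smul_left hf hZ,
      map_add, add_apply]
    simp only [hs _ (Z _) (Y _), hs _ (Z _) (X _), dirDeriv_eq_mvfderiv]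
    ring
  add {Z Z'} hZ hZ' := by
    have hX := hX.mdifferentiableAt p
    have hY := hY.mdifferentiableAt p
    have h1 := dirDeriv_add (X := X) (hg.mdifferentiableAt_apply hY hZ)
      (hg.mdifferentiableAt_apply hY hZ')
    have h2 := dirDeriv_add (X := Y) (hg.mdifferentiableAt_apply hZ hX)
      (hg.mdifferentiableAt_apply hZ' hX)
    simp only [dualConn, Pi.add_apply, map_add, add_apply,
      dirDeriv_field_add, h1, h2, mlieBracket_add_right hZ hZ', mlieBracket_add_left hZ hZ']
    ring

theorem dualConn_congr_right (hg : IsSmoothBilinField g)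
    (hs : ∀ (p : M) (v w : TangentSpace (𝓡 d) p), g p v w = g p w v)
    (hX : IsSmoothVField X) (hY : IsSmoothVField Y) (hZ : IsSmoothVField Z)
    (hZ' : IsSmoothVField Z') (h : Z p = Z' p) : dualConn g X Y Z p = dualConn g X Y Z' p :=
  have : IsManifold (𝓡 d) 1 M := IsManifold.of_le (n := ∞) (by simp)
  (tensorialAt_dualConn_right hg hs hX hY).pointwise (hZ.mdifferentiableAt p)
    (hZ'.mdifferentiableAt p) h

theorem dualConn_add_right (hg : IsSmoothBilinField g)
    (hs : ∀ (p : M) (v w : TangentSpace (𝓡 d) p), g p v w = g p w v)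
    (hX : IsSmoothVField X) (hY : IsSmoothVField Y) (hZ : IsSmoothVField Z)
    (hZ' : IsSmoothVField Z') :
    dualConn g X Y (Z + Z') p = dualConn g X Y Z p + dualConn g X Y Z' p :=
  (tensorialAt_dualConn_right hg hs hX hY).add (hZ.mdifferentiableAt p) (hZ'.mdifferentiableAt p)

theorem dualConn_smul_right (hg : IsSmoothBilinField g)
    (hs : ∀ (p : M) (v w : TangentSpace (𝓡 d) p), g p v w = g p w v)
    (hX : IsSmoothVField X) (hY : IsSmoothVField Y) {f : M → ℝ}
    (hf : ContMDiff (𝓡 d) 𝓘(ℝ, ℝ) ∞ f) (hZ : IsSmoothVField Z) :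
    dualConn g X Y (f • Z) p = f p * dualConn g X Y Z p :=
  (tensorialAt_dualConn_right hg hs hX hY).smul (hf.mdifferentiableAt (by simp))
    (hZ.mdifferentiableAt p)

theorem dualConn_sum_right (hg : IsSmoothBilinField g)
    (hs : ∀ (p : M) (v w : TangentSpace (𝓡 d) p), g p v w = g p w v)
    (hX : IsSmoothVField X) (hY : IsSmoothVField Y) {ι : Type*} [Fintype ι] {c : ι → M → ℝ}
    (hc : ∀ i, ContMDiff (𝓡 d) 𝓘(ℝ, ℝ) ∞ (c i)) {E : ι → VField d M}
    (hE : ∀ i, IsSmoothVField (E i)) :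
    dualConn g X Y (fun x => ∑ i, c i x • E i x) p = ∑ i, c i p * dualConn g X Y (E i) p := by
  have h := (tensorialAt_dualConn_right (p := p) hg hs hX hY).sum (s := Finset.univ)
    (fun i => c i • E i) (fun i _ => ((hE i).smul (hc i)).mdifferentiableAt p)
  exact h.trans (Finset.sum_congr rfl fun i _ => dualConn_smul_right hg hs hX hY (hc i) (hE i))

end DualConnection

/-! ### Degenerate points, local frames, and the covariant derivative on the regular part. -/

section Degenerate

variable {d : ℕ} {M : Type*} [TopologicalSpace M] [ChartedSpace (EuclideanSpace ℝ (Fin d)) M]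
  {g : BilinField d M}

theorem mem_singularSet_iff {p : M} :
    p ∈ singularSet g ↔ ∃ v : TangentSpace (𝓡 d) p, v ≠ 0 ∧ g p v = 0 := by
  rw [singularSet, Set.mem_ofPred_eq, Submodule.ne_bot_iff]
  exact ⟨fun ⟨v, h1, h2⟩ => ⟨v, h2, h1⟩, fun ⟨v, h1, h2⟩ => ⟨v, h2, h1⟩⟩

end Degenerate

section Frames

variable {d : ℕ} {M : Type*} [TopologicalSpace M] [ChartedSpace (EuclideanSpace ℝ (Fin d)) M]
  [IsManifold (𝓡 d) ∞ M] {g : BilinField d M}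

/-- The local frame of the tangent bundle given by the trivialization around `p`. -/
def trivFrame (p : M) : Fin d → VField d M :=
  (trivializationAt (EuclideanSpace ℝ (Fin d)) (TangentSpace (𝓡 d) : M → Type _) p).localFrame
    (EuclideanSpace.basisFun (Fin d) ℝ).toBasis

/-- Links the frame whose smoothness is provided by the bundle structure to the coordinate fields
that define `gramDet`. -/
theorem trivFrame_eq_coordField (p : M) {x : M}
    (hx : x ∈ (chartAt (EuclideanSpace ℝ (Fin d)) p).source) (a : Fin d) :
    trivFrame p a x = coordField p a x := by
  have : IsManifold (𝓡 d) 1 M := IsManifold.of_le (n := ∞) (by simp)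
  have hx' : x ∈ (trivializationAt (EuclideanSpace ℝ (Fin d))
      (TangentSpace (𝓡 d) : M → Type _) p).baseSet := by simpa using hx
  have h2 := TangentBundle.symmL_trivializationAt (I := 𝓡 d) hx
  have h3 := DFunLike.congr_fun h2 (EuclideanSpace.single a (1 : ℝ))
  simp only [trivFrame, Trivialization.localFrame_apply_of_mem_baseSet _ _ hx',
    Trivialization.basisAt, Module.Basis.map_apply, OrthonormalBasis.coe_toBasis,
    EuclideanSpace.basisFun_apply, coordField]
  rw [modelWithCornersSelf_coe, Set.range_id, mfderivWithin_univ] at h3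
  rw [Trivialization.linearEquivAt_symm_apply]
  rwa [Trivialization.symmL_apply _ hx'] at h3

variable {X Y Z T : VField d M}

/-- Nondegeneracy makes v ↦ g(v, ·) injective, hence onto the dual by dimension, so it represents
the covector □_X Y. On the regular part `nabla` therefore never takes its default value 0. -/
theorem exists_eq_dualConn (hg : IsSmoothBilinField g)
    (hs : ∀ (p : M) (v w : TangentSpace (𝓡 d) p), g p v w = g p w v)
    {p : M} (hp : p ∈ regularPart g) (hX : IsSmoothVField X) (hY : IsSmoothVField Y) :
    ∃ v : TangentSpace (𝓡 d) p,
      ∀ Z : VField d M, IsSmoothVField Z → g p v (Z p) = dualConn g X Y Z p := by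
  have : IsManifold (𝓡 d) 1 M := IsManifold.of_le (n := ∞) (by simp)
  have ht := tensorialAt_dualConn_right (p := p) hg hs hX hY
  let B : TangentSpace (𝓡 d) p →ₗ[ℝ] Module.Dual ℝ (TangentSpace (𝓡 d) p) :=
    LinearMap.mk₂ ℝ (fun v w => g p v w) (by simp) (by simp) (by simp) (by simp)
  have hinj : Function.Injective B := by
    rw [← LinearMap.ker_eq_bot, Submodule.eq_bot_iff]
    intro v hv
    by_contra hne
    refine hp (mem_singularSet_iff.2 ⟨v, hne, ?_⟩)
    ext u
    exact DFunLike.congr_fun (LinearMap.mem_ker.1 hv) u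
  have : FiniteDimensional ℝ (TangentSpace (𝓡 d) p) :=
    inferInstanceAs (FiniteDimensional ℝ (EuclideanSpace ℝ (Fin d)))
  have hsurj : Function.Surjective B :=
    (LinearMap.injective_iff_surjective_of_finrank_eq_finrank
      (Subspace.dual_finrank_eq).symm).1 hinj
  obtain ⟨v, hv⟩ := hsurj (TensorialAt.mkHom _ p ht).toLinearMap
  refine ⟨v, fun Z hZ => ?_⟩
  have := DFunLike.congr_fun hv (Z p)
  exact this.trans (TensorialAt.mkHom_apply ht (hZ.mdifferentiableAt p))

variable [T2Space M] [SecondCountableTopology M]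

/-- Around every point there is a frame of smooth global vector fields agreeing with the coordinate
fields. -/
theorem exists_isSmoothVField_frame (p : M) :
    ∃ E : Fin d → VField d M, (∀ a, IsSmoothVField (E a)) ∧
      (∀ᶠ x in 𝓝 p, ∀ a, E a x = coordField p a x) ∧
      (∀ᶠ x in 𝓝 p, ∃ b : Module.Basis (Fin d) ℝ (TangentSpace (𝓡 d) x), ∀ a, b a = E a x) ∧
      ∀ X : VField d M, IsSmoothVField X → ∃ c : Fin d → M → ℝ,
        (∀ a, ContMDiff (𝓡 d) 𝓘(ℝ, ℝ) ∞ (c a)) ∧ ∀ᶠ x in 𝓝 p, X x = ∑ a, c a x • E a x := by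
  have : IsManifold (𝓡 d) 1 M := IsManifold.of_le (n := ∞) (by simp)
  set e := trivializationAt (EuclideanSpace ℝ (Fin d)) (TangentSpace (𝓡 d) : M → Type _) p with he
  set b := (EuclideanSpace.basisFun (Fin d) ℝ).toBasis
  have hp : p ∈ e.baseSet := FiberBundle.mem_baseSet_trivializationAt _ _ p
  have hev : ∀ᶠ x in 𝓝 p, x ∈ e.baseSet := e.open_baseSet.mem_nhds hp
  have hsm : ∀ a, ∃ W : VField d M, IsSmoothVField W ∧ W =ᶠ[𝓝 p] trivFrame p a := fun a =>
    exists_isSmoothVField_eventuallyEq (hev.mono fun x hx =>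
      contMDiffAt_localFrame_of_mem ∞ e b a hx)
  choose E hE hEe using hsm
  have hall : ∀ᶠ x in 𝓝 p, ∀ a, E a x = trivFrame p a x := Filter.eventually_all.2 hEe
  refine ⟨E, hE, ?_, ?_, fun X hX => ?_⟩
  · filter_upwards [hall, (chartAt (EuclideanSpace ℝ (Fin d)) p).open_source.mem_nhds
      (mem_chart_source _ p)] with x h1 h2 a
    rw [h1, trivFrame_eq_coordField p h2]
  · filter_upwards [hall, hev] with x h1 h2
    refine ⟨e.basisAt b h2, fun a => ?_⟩
    rw [h1, trivFrame, Trivialization.localFrame_apply_of_mem_baseSet _ _ h2]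
  · have hc : ∀ a, ∃ c : M → ℝ, ContMDiff (𝓡 d) 𝓘(ℝ, ℝ) ∞ c ∧ c =ᶠ[𝓝 p]
        LinearMap.piApply (e.localFrameCoeff (𝓡 d) b a) X := fun a =>
      exists_contMDiff_eventuallyEq (hev.mono fun x hx =>
        contMDiffAt_localFrameCoeff b hx (hX x) a)
    choose c hc hce using hc
    refine ⟨c, hc, ?_⟩
    filter_upwards [hall, Filter.eventually_all.2 hce, hev] with x h1 h2 h3
    rw [e.eq_sum_localFrameCoeff_smul (I := 𝓡 d) (b := b) h3 (s := X)]
    exact Finset.sum_congr rfl fun a _ => by rw [h2, h1]; rfl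

theorem exists_isSmoothVField_apply_eq (p : M) (v : TangentSpace (𝓡 d) p) :
    ∃ X : VField d M, IsSmoothVField X ∧ X p = v := by
  obtain ⟨E, hE, -, hb, -⟩ := exists_isSmoothVField_frame (d := d) p
  obtain ⟨b, hb⟩ := hb.self_of_nhds
  have hsum : IsSmoothVField (fun x => ∑ a, (b.repr v a • E a) x) :=
    IsSmoothVField.sum fun a => (hE a).const_smul _
  refine ⟨_, hsum, ?_⟩
  simp only [Pi.smul_apply, ← hb]
  exact b.sum_repr v

theorem eq_of_mem_regularPart {p : M} (hp : p ∈ regularPart g) {v w : TangentSpace (𝓡 d) p}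
    (h : ∀ Z : VField d M, IsSmoothVField Z → g p v (Z p) = g p w (Z p)) : v = w := by
  by_contra hne
  refine hp (mem_singularSet_iff.2 ⟨v - w, sub_ne_zero.2 hne, ?_⟩)
  ext u
  obtain ⟨Z, hZ, rfl⟩ := exists_isSmoothVField_apply_eq p u
  simp [h Z hZ]

/-- A vector representing the dual connection is the covariant derivative. -/
theorem nabla_eq {p : M} (hp : p ∈ regularPart g) {v : TangentSpace (𝓡 d) p}
    (h : ∀ Z : VField d M, IsSmoothVField Z → g p v (Z p) = dualConn g X Y Z p) :
    nabla g X Y p = v := by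
  have hex : ∃ v : TangentSpace (𝓡 d) p,
      ∀ Z : VField d M, IsSmoothVField Z → g p v (Z p) = dualConn g X Y Z p := ⟨v, h⟩
  rw [nabla, dif_pos hex]
  exact eq_of_mem_regularPart hp fun Z hZ => by rw [hex.choose_spec Z hZ, h Z hZ]

theorem apply_nabla (hg : IsSmoothBilinField g)
    (hs : ∀ (p : M) (v w : TangentSpace (𝓡 d) p), g p v w = g p w v)
    {p : M} (hp : p ∈ regularPart g) (hX : IsSmoothVField X) (hY : IsSmoothVField Y)
    (hZ : IsSmoothVField Z) : g p (nabla g X Y p) (Z p) = dualConn g X Y Z p := by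
  obtain ⟨v, hv⟩ := exists_eq_dualConn hg hs hp hX hY
  rw [nabla_eq hp hv, hv Z hZ]

end Frames

/-! ### Gram matrices, extension of covariant derivatives, and the curvature formula. -/

section Gram

variable {d : ℕ} {M : Type*} [TopologicalSpace M] [ChartedSpace (EuclideanSpace ℝ (Fin d)) M]
  {g : BilinField d M}

/-- The Gram matrix of a family of vector fields. -/
def gram (g : BilinField d M) (E : Fin d → VField d M) (x : M) : Matrix (Fin d) (Fin d) ℝ :=
  Matrix.of fun a b => g x (E a x) (E b x)

theorem gram_apply (E : Fin d → VField d M) (x : M) (a b : Fin d) :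
    gram g E x a b = g x (E a x) (E b x) := rfl

theorem contMDiff_det {A : M → Matrix (Fin d) (Fin d) ℝ}
    (hA : ∀ a b, ContMDiff (𝓡 d) 𝓘(ℝ, ℝ) ∞ fun x => A x a b) :
    ContMDiff (𝓡 d) 𝓘(ℝ, ℝ) ∞ fun x => (A x).det := by
  simp only [Matrix.det_apply']
  refine contMDiff_finsetSum fun σ _ => contMDiff_const.mul ?_
  exact contMDiff_finsetProd fun i _ => hA _ _

theorem contMDiff_adjugate {A : M → Matrix (Fin d) (Fin d) ℝ}
    (hA : ∀ a b, ContMDiff (𝓡 d) 𝓘(ℝ, ℝ) ∞ fun x => A x a b) (a b : Fin d) :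
    ContMDiff (𝓡 d) 𝓘(ℝ, ℝ) ∞ fun x => (A x).adjugate a b := by
  simp only [Matrix.adjugate_apply]
  refine contMDiff_det fun i j => ?_
  by_cases h : i = b
  · subst h
    simp only [Matrix.updateRow_self]
    exact contMDiff_const
  · simp only [Matrix.updateRow_ne h]
    exact hA i j

theorem apply_sum_left (g : BilinField d M) (E : Fin d → VField d M) (x : M) (c : Fin d → ℝ)
    (w : TangentSpace (𝓡 d) x) : g x (∑ a, c a • E a x) w = ∑ a, c a * g x (E a x) w := by
  simp [map_sum]

theorem apply_sum_right (g : BilinField d M) (E : Fin d → VField d M) (x : M) (c : Fin d → ℝ)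
    (w : TangentSpace (𝓡 d) x) : g x w (∑ a, c a • E a x) = ∑ a, c a * g x w (E a x) := by
  simp [map_sum]

theorem mem_radical_iff_of_basis (hs : ∀ (p : M) (v w : TangentSpace (𝓡 d) p), g p v w = g p w v)
    {E : Fin d → VField d M} {x : M} {b : Module.Basis (Fin d) ℝ (TangentSpace (𝓡 d) x)}
    (hb : ∀ a, b a = E a x) {v : TangentSpace (𝓡 d) x} :
    v ∈ radical g x ↔ ∀ a, g x (E a x) v = 0 := by
  constructor
  · intro h a
    rw [hs, show g x v = 0 from h]; rfl
  · intro h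
    have : (g x v).toLinearMap = 0 := b.ext fun a => by
      have := h a
      rw [hs] at this
      simpa [hb] using! this
    change g x v = 0
    ext w
    exact DFunLike.congr_fun this w

theorem mem_singularSet_iff_det (hs : ∀ (p : M) (v w : TangentSpace (𝓡 d) p), g p v w = g p w v)
    {E : Fin d → VField d M} {x : M} {b : Module.Basis (Fin d) ℝ (TangentSpace (𝓡 d) x)}
    (hb : ∀ a, b a = E a x) : x ∈ singularSet g ↔ (gram g E x).det = 0 := by
  rw [← Matrix.exists_mulVec_eq_zero_iff, mem_singularSet_iff]
  constructor
  · rintro ⟨v, hv, h⟩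
    refine ⟨b.equivFun v, by simpa using hv, ?_⟩
    ext a
    have h1 : v = ∑ a, b.equivFun v a • E a x := by
      conv_lhs => rw [← b.sum_equivFun v]
      simp [hb]
    have h2 := (mem_radical_iff_of_basis hs hb).1 (show v ∈ radical g x from h) a
    rw [h1, apply_sum_right] at h2
    simpa [Matrix.mulVec, dotProduct, gram_apply, mul_comm] using h2
  · rintro ⟨c, hc, h⟩
    refine ⟨∑ a, c a • E a x, fun h0 => hc ?_, ?_⟩
    · have := Fintype.linearIndependent_iff.1 b.linearIndependent c (by simpa [hb] using h0)
      exact funext this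
    · refine (mem_radical_iff_of_basis hs hb).2 fun a => ?_
      rw [apply_sum_right]
      have := congrFun h a
      simpa [Matrix.mulVec, dotProduct, gram_apply, mul_comm] using this

/-- The columns of the adjugate of the Gram matrix are radical vectors where `g` degenerates. -/
theorem sum_adjugate_smul_mem_radical
    (hs : ∀ (p : M) (v w : TangentSpace (𝓡 d) p), g p v w = g p w v)
    {E : Fin d → VField d M} {x : M} {b : Module.Basis (Fin d) ℝ (TangentSpace (𝓡 d) x)}
    (hb : ∀ a, b a = E a x) (hx : (gram g E x).det = 0) (a : Fin d) :
    ∑ e, (gram g E x).adjugate e a • E e x ∈ radical g x := by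
  refine (mem_radical_iff_of_basis hs hb).2 fun c => ?_
  rw [apply_sum_right]
  have := congrFun (congrFun (Matrix.mul_adjugate (gram g E x)) c) a
  rw [hx, zero_smul] at this
  simpa [Matrix.mul_apply, gram_apply, mul_comm] using this

theorem gram_det_eventuallyEq {E : Fin d → VField d M} {p : M}
    (hE : ∀ᶠ x in 𝓝 p, ∀ a, E a x = coordField p a x) :
    (fun x => (gram g E x).det) =ᶠ[𝓝 p] gramDet g p := by
  filter_upwards [hE] with x hx
  simp only [gram, gramDet, hx]

variable [IsManifold (𝓡 d) ∞ M]

theorem contMDiff_gram_det (hg : IsSmoothBilinField g) {E : Fin d → VField d M}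
    (hE : ∀ a, IsSmoothVField (E a)) :
    ContMDiff (𝓡 d) 𝓘(ℝ, ℝ) ∞ fun x => (gram g E x).det :=
  contMDiff_det fun a b => hg.contMDiff_apply (hE a) (hE b)

theorem contMDiff_gram_adjugate (hg : IsSmoothBilinField g) {E : Fin d → VField d M}
    (hE : ∀ a, IsSmoothVField (E a)) (a b : Fin d) :
    ContMDiff (𝓡 d) 𝓘(ℝ, ℝ) ∞ fun x => (gram g E x).adjugate a b :=
  contMDiff_adjugate (fun a b => hg.contMDiff_apply (hE a) (hE b)) a b

variable [T2Space M] [SecondCountableTopology M]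

theorem isOpen_regularPart (hg : IsSmoothBilinField g)
    (hs : ∀ (p : M) (v w : TangentSpace (𝓡 d) p), g p v w = g p w v) :
    IsOpen (regularPart g) := by
  rw [isOpen_iff_mem_nhds]
  intro p hp
  obtain ⟨E, hE, -, hb, -⟩ := exists_isSmoothVField_frame (d := d) p
  obtain ⟨b, hbp⟩ := hb.self_of_nhds
  have hne : (gram g E p).det ≠ 0 := fun h => hp ((mem_singularSet_iff_det hs hbp).2 h)
  filter_upwards [(contMDiff_gram_det hg hE).continuous.continuousAt.eventually_ne hne, hb]
    with x hx ⟨b, hb⟩ h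
  exact hx ((mem_singularSet_iff_det hs hb).1 h)

variable {X Y Z T : VField d M}

/-- Near a point where the Gram determinant is regular or nonzero, `∇_X Y` extends smoothly if
`□_X Y` vanishes on the radicals. -/
theorem exists_nabla_extension_nhds (hg : IsSmoothBilinField g)
    (hs : ∀ (p : M) (v w : TangentSpace (𝓡 d) p), g p v w = g p w v) {p : M}
    (ht : p ∈ singularSet g → mfderiv (𝓡 d) 𝓘(ℝ, ℝ) (gramDet g p) p ≠ 0)
    (hX : IsSmoothVField X) (hY : IsSmoothVField Y)
    (hK : ∀ᶠ x in 𝓝 p, x ∈ singularSet g → ∀ Z : VField d M, IsSmoothVField Z →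
      Z x ∈ radical g x → dualConn g X Y Z x = 0) :
    ∃ V : VField d M, IsSmoothVField V ∧ ∀ᶠ x in 𝓝 p, x ∈ regularPart g → V x = nabla g X Y x := by
  obtain ⟨E, hE, hEc, hb, -⟩ := exists_isSmoothVField_frame (d := d) p
  have hD := contMDiff_gram_det hg hE
  have hA := contMDiff_gram_adjugate hg hE
  have hDp : (gram g E p).det ≠ 0 ∨
      mfderiv (𝓡 d) 𝓘(ℝ, ℝ) (fun x => (gram g E x).det) p ≠ 0 := by
    by_cases hp : p ∈ singularSet g
    · right
      rw [(gram_det_eventuallyEq hEc).mfderiv_eq]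
      exact ht hp
    · obtain ⟨b, hbp⟩ := hb.self_of_nhds
      exact Or.inl fun h => hp ((mem_singularSet_iff_det hs hbp).2 h)
  -- By Cramer's rule these sums, divided by the determinant, are the frame coordinates of ∇_X Y.
  -- Each sum is □_X Y evaluated on a column of the adjugate, which is radical where the determinant
  -- vanishes; `hK` then gives the vanishing that Hadamard's lemma needs.
  have hh : ∀ a, ∃ h : M → ℝ, ContMDiff (𝓡 d) 𝓘(ℝ, ℝ) ∞ h ∧ ∀ᶠ x in 𝓝 p,
      ∑ e, (gram g E x).adjugate e a * dualConn g X Y (E e) x = (gram g E x).det * h x := by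
    intro a
    refine exists_contMDiff_eq_mul
      (f := fun x => ∑ e, (gram g E x).adjugate e a * dualConn g X Y (E e) x) hD
      (contMDiff_finsetSum fun e _ =>
      (hA e a).mul (contMDiff_dualConn hg hX hY (hE e))) hDp ?_
    filter_upwards [hK, hb] with x hKx ⟨b, hb⟩ hx
    rw [← dualConn_sum_right hg hs hX hY (fun e => hA e a) hE]
    exact hKx ((mem_singularSet_iff_det hs hb).2 hx) _
      (IsSmoothVField.sum fun e => (hE e).smul (hA e a))
      (sum_adjugate_smul_mem_radical hs hb hx a)
  choose h hh hmul using hh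
  have hV : IsSmoothVField fun x => ∑ a, (h a • E a) x :=
    IsSmoothVField.sum fun a => (hE a).smul (hh a)
  refine ⟨_, hV, ?_⟩
  filter_upwards [Filter.eventually_all.2 hmul, hb] with x hx ⟨b, hb⟩ hreg
  have hne : (gram g E x).det ≠ 0 := fun h => hreg ((mem_singularSet_iff_det hs hb).2 h)
  have key : ∀ c, g x (∑ a, h a x • E a x) (E c x) = dualConn g X Y (E c) x := by
    intro c
    rw [apply_sum_left]
    refine mul_left_cancel₀ hne ?_
    calc (gram g E x).det * ∑ a, h a x * g x (E a x) (E c x)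
        = ∑ a, (∑ e, (gram g E x).adjugate e a * dualConn g X Y (E e) x) * gram g E x a c := by
          rw [Finset.mul_sum]
          refine Finset.sum_congr rfl fun a _ => ?_
          rw [hx a, gram_apply]; ring
      _ = ∑ e, ((gram g E x).adjugate * gram g E x) e c * dualConn g X Y (E e) x := by
          simp only [Finset.sum_mul, Matrix.mul_apply]
          rw [Finset.sum_comm]
          exact Finset.sum_congr rfl fun a _ => Finset.sum_congr rfl fun e _ => by ring
      _ = (gram g E x).det * dualConn g X Y (E c) x := by
          rw [Matrix.adjugate_mul]
          simp [Matrix.one_apply]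
  refine (nabla_eq hreg fun Z hZ => ?_).symm
  -- Tensoriality allows Z to be replaced by the combination of frame fields with coefficients
  -- frozen at x.
  have hsum : IsSmoothVField (fun y => ∑ a, (b.repr (Z x) a • E a) y) :=
    IsSmoothVField.sum fun a => (hE a).const_smul _
  have hZx : Z x = ∑ a, b.repr (Z x) a • E a x := by
    simp only [← hb]
    exact (b.sum_repr _).symm
  rw [dualConn_congr_right hg hs hX hY hZ hsum hZx]
  have h2 := dualConn_sum_right (p := x) hg hs hX hY (c := fun a _ => b.repr (Z x) a)
    (fun a => contMDiff_const) hE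
  refine Eq.trans ?_ h2.symm
  rw [hZx]
  refine (apply_sum_right g E x _ _).trans (Finset.sum_congr rfl fun a _ => ?_)
  rw [← hZx]
  exact congrArg _ (key a)

/-- Around points where `g` is nondegenerate, the covariant derivative is smooth. -/
theorem exists_nabla_eventuallyEq (hg : IsSmoothBilinField g)
    (hs : ∀ (p : M) (v w : TangentSpace (𝓡 d) p), g p v w = g p w v) {p : M}
    (hp : p ∈ regularPart g) (hX : IsSmoothVField X) (hY : IsSmoothVField Y) :
    ∃ V : VField d M, IsSmoothVField V ∧ nabla g X Y =ᶠ[𝓝 p] V := by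
  have hreg : ∀ᶠ x in 𝓝 p, x ∈ regularPart g := (isOpen_regularPart hg hs).mem_nhds hp
  obtain ⟨V, hV, h⟩ := exists_nabla_extension_nhds hg hs (p := p) (fun h => (hp h).elim) hX hY
    (hreg.mono fun x hx h => (hx h).elim)
  exact ⟨V, hV, by filter_upwards [h, hreg] with x h1 h2 using (h1 h2).symm⟩

/-- The covariant curvature in terms of the dual connection, at points where `g` is
nondegenerate. -/
theorem covCurvature_eq (hg : IsSmoothBilinField g)
    (hs : ∀ (p : M) (v w : TangentSpace (𝓡 d) p), g p v w = g p w v) {p : M}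
    (hp : p ∈ regularPart g) (hX : IsSmoothVField X) (hY : IsSmoothVField Y)
    (hZ : IsSmoothVField Z) (hT : IsSmoothVField T) {A B : VField d M} (hA : IsSmoothVField A)
    (hB : IsSmoothVField B) (hAe : nabla g Y Z =ᶠ[𝓝 p] A) (hBe : nabla g X Z =ᶠ[𝓝 p] B) :
    covCurvature g X Y Z T p = dualConn g X A T p - dualConn g Y B T p
      - dualConn g (mlieBracket (𝓡 d) X Y) Z T p := by
  -- The field `nabla g Y Z` need not be smooth on all of M, but □ depends only on germs, so the
  -- global smooth field `A` can stand in for it.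
  have h1 : nabla g X (nabla g Y Z) p = nabla g X A p := by
    refine nabla_eq hp fun W hW => ?_
    rw [apply_nabla hg hs hp hX hA hW]
    exact dualConn_congr (.refl _ _) hAe.symm (.refl _ _)
  have h2 : nabla g Y (nabla g X Z) p = nabla g Y B p := by
    refine nabla_eq hp fun W hW => ?_
    rw [apply_nabla hg hs hp hY hB hW]
    exact dualConn_congr (.refl _ _) hBe.symm (.refl _ _)
  rw [covCurvature, curvature, h1, h2]
  simp only [map_sub, sub_apply]
  rw [apply_nabla hg hs hp hX hA hT, apply_nabla hg hs hp hY hB hT,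
    apply_nabla hg hs hp (hX.mlieBracket hY) hZ hT]

end Gram

/-! ### The radical on Σ, and the first-order behaviour of the determinant. -/

section Radical

variable {d : ℕ} {M : Type*} [TopologicalSpace M] [ChartedSpace (EuclideanSpace ℝ (Fin d)) M]
  {g : BilinField d M} {p : M}

/-- `d_p (det (g_ab))` as a linear form. -/
def detForm (g : BilinField d M) (p : M) : TangentSpace (𝓡 d) p →L[ℝ] ℝ :=
  mvfderiv (𝓡 d) (gramDet g p) p

theorem mem_tangentSigma_iff {v : TangentSpace (𝓡 d) p} :
    v ∈ tangentSigma g p ↔ detForm g p v = 0 := Iff.rfl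

theorem dirDeriv_gramDet (X : VField d M) : dirDeriv X (gramDet g p) p = detForm g p (X p) := rfl

theorem detForm_ne_zero (hrad : HasTransverseRadical g) (hp : p ∈ singularSet g)
    {r : TangentSpace (𝓡 d) p} (hr : r ∈ radical g p) (h0 : r ≠ 0) : detForm g p r ≠ 0 :=
  fun h => h0 ((Submodule.disjoint_def.1 (hrad p hp).disjoint) r hr (mem_tangentSigma_iff.2 h))

/-- The radical meets ker d det only in 0, so the linear form d det is injective on it; the
coefficient is read off by applying that form. -/
theorem eq_smul_of_mem_radical (hrad : HasTransverseRadical g) (hp : p ∈ singularSet g)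
    {r v : TangentSpace (𝓡 d) p} (hr : r ∈ radical g p) (h0 : r ≠ 0) (hv : v ∈ radical g p) :
    v = (detForm g p v / detForm g p r) • r := by
  have h1 := detForm_ne_zero hrad hp hr h0
  refine sub_eq_zero.1 ((Submodule.disjoint_def.1 (hrad p hp).disjoint) _
    (Submodule.sub_mem _ hv (Submodule.smul_mem _ _ hr)) (mem_tangentSigma_iff.2 ?_))
  rw [map_sub, map_smul, smul_eq_mul]
  field_simp
  ring

variable [IsManifold (𝓡 d) ∞ M]

/-- At a degenerate point, the differential of the Gram determinant is proportional to that of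
`g(R, R)`, and the adjugate of the Gram matrix is proportional to `R ⊗ R`. -/
theorem exists_detForm_eq_mul (hg : IsSmoothBilinField g)
    (hs : ∀ (p : M) (v w : TangentSpace (𝓡 d) p), g p v w = g p w v)
    (hrad : HasTransverseRadical g) (hp : p ∈ singularSet g) {R : VField d M}
    (hR : IsSmoothVField R) (hRp : R p ∈ radical g p) (hR0 : R p ≠ 0)
    {E : Fin d → VField d M} (hE : ∀ a, IsSmoothVField (E a))
    (hEc : ∀ᶠ x in 𝓝 p, ∀ a, E a x = coordField p a x)
    {b : Module.Basis (Fin d) ℝ (TangentSpace (𝓡 d) p)} (hb : ∀ a, b a = E a p)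
    {c : Fin d → M → ℝ} (hc : ∀ a, ContMDiff (𝓡 d) 𝓘(ℝ, ℝ) ∞ (c a))
    (hRc : ∀ᶠ x in 𝓝 p, R x = ∑ a, c a x • E a x) :
    ∃ κ : ℝ, (∀ X : VField d M,
      detForm g p (X p) = κ * dirDeriv X (fun x => g x (R x) (R x)) p) ∧
      ∀ a e, (gram g E p).adjugate a e = κ * c a p * c e p := by
  have hdet : (gram g E p).det = 0 := (mem_singularSet_iff_det hs hb).1 hp
  have hD := contMDiff_gram_det hg hE
  have hA := contMDiff_gram_adjugate hg hE
  have hRp' : g p (R p) = 0 := hRp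
  have hω : ∀ e, ContMDiff (𝓡 d) 𝓘(ℝ, ℝ) ∞ fun x => g x (E e x) (R x) := fun e =>
    hg.contMDiff_apply (hE e) hR
  have hω0 : ∀ e, g p (E e p) (R p) = 0 := fun e => by rw [hs, hRp']; rfl
  have md : ∀ {f : M → ℝ}, ContMDiff (𝓡 d) 𝓘(ℝ, ℝ) ∞ f → MDifferentiableAt (𝓡 d) 𝓘(ℝ, ℝ) f p :=
    fun hf => hf.mdifferentiableAt (by simp)
  -- The values g(E_e, R) form the vector G c, so this is adj(G) G c = det(G) c. At p both det and
  -- all g(E_e, R) vanish, so differentiating involves no derivative of the adjugate or of c.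
  have h1 : ∀ a, (fun x => (gram g E x).det * c a x) =ᶠ[𝓝 p]
      fun x => ∑ e, (gram g E x).adjugate a e * g x (E e x) (R x) := by
    intro a
    filter_upwards [hRc] with x hx
    rw [hx]
    simp only [apply_sum_right]
    have := congrFun (congrArg (fun B => B.mulVec fun i => c i x)
      (Matrix.adjugate_mul (gram g E x))) a
    simp only [← Matrix.mulVec_mulVec] at this
    simp only [Matrix.mulVec, dotProduct, Matrix.smul_apply, Matrix.one_apply, smul_eq_mul,
      mul_ite, mul_one, mul_zero, ite_mul, zero_mul, Finset.sum_ite_eq, Finset.mem_univ,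
      if_true] at this
    rw [← this]
    simp only [gram_apply]
    exact Finset.sum_congr rfl fun i _ => congrArg _ (Finset.sum_congr rfl fun j _ => mul_comm _ _)
  have h2 : (fun x => g x (R x) (R x)) =ᶠ[𝓝 p] fun x => ∑ e, c e x * g x (E e x) (R x) := by
    filter_upwards [hRc] with x hx
    conv_lhs => rw [hx]
    rw [apply_sum_left, ← hx]
  have hDX : ∀ X : VField d M,
      dirDeriv X (fun x => (gram g E x).det) p = detForm g p (X p) := fun X =>
    (dirDeriv_congr (gram_det_eventuallyEq hEc)).trans (dirDeriv_gramDet X)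
  have h3 : ∀ (X : VField d M) a, detForm g p (X p) * c a p =
      ∑ e, (gram g E p).adjugate a e * dirDeriv X (fun x => g x (E e x) (R x)) p := by
    intro X a
    have h4 := dirDeriv_congr (X := X) (h1 a)
    rw [dirDeriv_mul (md hD) (md (hc a)),
      dirDeriv_sum (F := fun e x => (gram g E x).adjugate a e * g x (E e x) (R x))
        fun e _ => md ((hA a e).mul (hω e)), hdet, hDX] at h4
    simp only [dirDeriv_mul (md (hA a _)) (md (hω _)), hω0, zero_mul, zero_add, add_zero] at h4
    rw [mul_comm, h4]
  have h5 : ∀ X : VField d M, dirDeriv X (fun x => g x (R x) (R x)) p =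
      ∑ e, c e p * dirDeriv X (fun x => g x (E e x) (R x)) p := by
    intro X
    rw [dirDeriv_congr h2, dirDeriv_sum (F := fun e x => c e x * g x (E e x) (R x))
      fun e _ => md ((hc e).mul (hω e))]
    simp only [dirDeriv_mul (md (hc _)) (md (hω _)), hω0]
    simp
  -- The columns of the adjugate are radical at p, hence multiples of c because the radical is a
  -- line; the symmetry of the adjugate then forces the form κ c ⊗ c.
  have hcol : ∀ a, ∃ l : ℝ, ∀ e, (gram g E p).adjugate e a = l * c e p := by
    intro a
    have h6 := eq_smul_of_mem_radical hrad hp hRp hR0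
      (sum_adjugate_smul_mem_radical hs hb hdet a)
    refine ⟨detForm g p (∑ e, (gram g E p).adjugate e a • E e p) / detForm g p (R p), fun e => ?_⟩
    · rw [hRc.self_of_nhds] at h6 ⊢
      simp only [← hb] at h6 ⊢
      have h7 := congrArg (fun v => b.repr v e) h6
      simpa [Finsupp.single_apply] using h7
  choose l hl using hcol
  have hsymm : ∀ a e, (gram g E p).adjugate a e = (gram g E p).adjugate e a := by
    intro a e
    have h8 : (gram g E p).transpose = gram g E p := by
      ext i j
      exact hs _ _ _
    have h9 := congrFun (congrFun (Matrix.adjugate_transpose (gram g E p)) a) e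
    rw [h8] at h9
    exact h9.symm
  obtain ⟨a₀, ha₀⟩ : ∃ a, c a p ≠ 0 := by
    by_contra! h
    exact hR0 (by rw [hRc.self_of_nhds]; simp [h])
  have hl' : ∀ a, l a = l a₀ / c a₀ p * c a p := by
    intro a
    have h9 := hsymm a a₀
    rw [hl, hl] at h9
    field_simp
    linarith
  refine ⟨l a₀ / c a₀ p, fun X => mul_right_cancel₀ ha₀ ?_, fun a e => ?_⟩
  · rw [h3, h5]
    simp only [hsymm a₀, hl, Finset.mul_sum, Finset.sum_mul]
    exact Finset.sum_congr rfl fun e _ => by field_simp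
  · rw [hl, hl' e]; ring

variable [T2Space M] [SecondCountableTopology M]

/-- Hadamard's lemma writes f = det · h near p, so X f = h · d det(X) at p. This ties
`tangentSigma`, defined as a kernel, to functions vanishing on Σ without any manifold structure on
Σ. -/
theorem dirDeriv_eq_zero_of_mem_tangentSigma (hg : IsSmoothBilinField g)
    (hs : ∀ (p : M) (v w : TangentSpace (𝓡 d) p), g p v w = g p w v) (hp : p ∈ singularSet g)
    (ht : mfderiv (𝓡 d) 𝓘(ℝ, ℝ) (gramDet g p) p ≠ 0) {f : M → ℝ}
    (hf : ContMDiff (𝓡 d) 𝓘(ℝ, ℝ) ∞ f) (hf0 : ∀ x ∈ singularSet g, f x = 0) {X : VField d M}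
    (hX : X p ∈ tangentSigma g p) : dirDeriv X f p = 0 := by
  obtain ⟨E, hE, hEc, hb, -⟩ := exists_isSmoothVField_frame (d := d) p
  have hD := contMDiff_gram_det hg hE
  obtain ⟨h, hh, he⟩ := exists_contMDiff_eq_mul hD hf (p := p)
    (Or.inr (by rw [(gram_det_eventuallyEq hEc).mfderiv_eq]; exact ht)) (by
      filter_upwards [hb] with x ⟨b, hb⟩ hx
      exact hf0 x ((mem_singularSet_iff_det hs hb).2 hx))
  obtain ⟨b, hb⟩ := hb.self_of_nhds
  rw [dirDeriv_congr he, dirDeriv_mul (hD.mdifferentiableAt (by simp))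
    (hh.mdifferentiableAt (by simp)), (mem_singularSet_iff_det hs hb).1 hp,
    dirDeriv_congr (gram_det_eventuallyEq hEc), dirDeriv_gramDet, mem_tangentSigma_iff.1 hX]
  ring

end Radical

/-! ### Density of the regular part and semidefiniteness on Σ. -/

section Positivity

variable {d : ℕ} {M : Type*} [TopologicalSpace M] [ChartedSpace (EuclideanSpace ℝ (Fin d)) M]
  {g : BilinField d M} {p : M}

theorem nonneg_of_index_eq_zero (h : index g p = 0) (v : TangentSpace (𝓡 d) p) :
    0 ≤ g p v v := by
  by_contra! hv
  have : FiniteDimensional ℝ (TangentSpace (𝓡 d) p) :=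
    inferInstanceAs (FiniteDimensional ℝ (EuclideanSpace ℝ (Fin d)))
  have hv0 : v ≠ 0 := by rintro rfl; simp at hv
  have hneg : ((-quadForm g p).restrict (ℝ ∙ v)).PosDef := by
    rintro ⟨w, hw⟩ hw0
    obtain ⟨a, rfl⟩ := Submodule.mem_span_singleton.1 hw
    have ha : a ≠ 0 := by rintro rfl; exact hw0 (by simp)
    have h1 : 0 < a * a * (-(g p v v)) := mul_pos (mul_self_pos.2 ha) (by linarith)
    have h2 : (-quadForm g p) (a • v) = -(g p (a • v) (a • v)) := rfl
    change 0 < (-quadForm g p) (a • v)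
    rw [h2]
    simp only [map_smul, smul_apply, smul_eq_mul]
    linarith
  have := le_sigNeg_of_negDef (quadForm g p) hneg
  rw [finrank_span_singleton hv0] at this
  rw [index] at h
  omega

variable [IsManifold (𝓡 d) ∞ M]

theorem dense_regularPart (hg : IsTransverseRiemannLorentz g) : Dense (regularPart g) := by
  intro p
  by_cases hp : p ∈ singularSet g
  · exact closure_mono (fun x hx => hx.1) (hg.separates hp).1
  · exact subset_closure hp

variable [T2Space M] [SecondCountableTopology M]

/-- Nonnegativity is a closed condition along a smooth extension of v, and p is a limit of
Riemannian points. -/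
theorem nonneg_of_mem_singularSet (hg : IsTransverseRiemannLorentz g) (hp : p ∈ singularSet g)
    (v : TangentSpace (𝓡 d) p) : 0 ≤ g p v v := by
  obtain ⟨Z, hZ, rfl⟩ := exists_isSmoothVField_apply_eq p v
  have hc : Continuous fun x => g x (Z x) (Z x) := (hg.smooth.contMDiff_apply hZ hZ).continuous
  have hcl : IsClosed {x | 0 ≤ g x (Z x) (Z x)} := isClosed_le continuous_const hc
  exact closure_minimal (fun x hx => nonneg_of_index_eq_zero hx.2 _) hcl (hg.separates hp).1

end Positivity

/-! ### Construction of global radical vector fields. -/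

section RadicalFields

variable {n : ℕ} {M : Type*} [TopologicalSpace M]
  [ChartedSpace (EuclideanSpace ℝ (Fin (n + 1))) M]
  {g : BilinField (n + 1) M} {p : M}

theorem posSemidef_gram (hs : ∀ (p : M) (v w : TangentSpace (𝓡 (n + 1)) p), g p v w = g p w v)
    (h : ∀ v : TangentSpace (𝓡 (n + 1)) p, 0 ≤ g p v v) (E : Fin (n + 1) → VField (n + 1) M) :
    (gram g E p).PosSemidef := by
  refine .of_dotProduct_mulVec_nonneg ?_ fun x => ?_
  · ext a b
    exact hs _ _ _
  · refine (h (∑ a, x a • E a p)).trans_eq ?_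
    rw [apply_sum_left]
    simp [dotProduct, Matrix.mulVec, gram_apply, mul_comm]

/-- A convex combination of nonzero radical vectors could vanish; requiring d det to be positive on
them excludes this and makes the condition suitable for a partition of unity. -/
theorem convex_radical_pos (g : BilinField (n + 1) M) (x : M) :
    Convex ℝ {v : TangentSpace (𝓡 (n + 1)) x |
      x ∈ singularSet g → v ∈ radical g x ∧ 0 < detForm g x v} := by
  intro v hv w hw a b ha hb hab hx
  obtain ⟨hv1, hv2⟩ := hv hx
  obtain ⟨hw1, hw2⟩ := hw hx
  refine ⟨add_mem (Submodule.smul_mem _ _ hv1) (Submodule.smul_mem _ _ hw1), ?_⟩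
  rw [map_add, map_smul, map_smul, smul_eq_mul, smul_eq_mul]
  rcases ha.eq_or_lt with rfl | ha
  · obtain rfl : b = 1 := by linarith
    simpa using hw2
  · have := mul_pos ha hv2
    have := mul_nonneg hb hw2.le
    linarith

theorem adjugate_diag_nonneg {A : Matrix (Fin (n + 1)) (Fin (n + 1)) ℝ} (hA : A.PosSemidef)
    (a : Fin (n + 1)) : 0 ≤ A.adjugate a a := by
  rw [Matrix.adjugate_fin_succ_eq_det_submatrix, ← two_mul, pow_mul]
  simpa using (hA.submatrix a.succAbove).det_nonneg

variable [IsManifold (𝓡 (n + 1)) ∞ M] [T2Space M] [SecondCountableTopology M]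

/-- At a degenerate point, the differential of the Gram determinant is a positive multiple of that
of `g(R, R)`. -/
theorem exists_pos_detForm_eq_mul (hg : IsTransverseRiemannLorentz g)
    (hrad : HasTransverseRadical g) (hp : p ∈ singularSet g) {R : VField (n + 1) M}
    (hR : IsSmoothVField R) (hRp : R p ∈ radical g p) (hR0 : R p ≠ 0) :
    ∃ κ > 0, ∀ X : VField (n + 1) M,
      detForm g p (X p) = κ * dirDeriv X (fun x => g x (R x) (R x)) p := by
  obtain ⟨E, hE, hEc, hb, hcoef⟩ := exists_isSmoothVField_frame (d := n + 1) p
  obtain ⟨c, hc, hRc⟩ := hcoef R hR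
  obtain ⟨b, hb⟩ := hb.self_of_nhds
  obtain ⟨κ, h1, h2⟩ :=
    exists_detForm_eq_mul hg.smooth hg.symm hrad hp hR hRp hR0 hE hEc hb hc hRc
  refine ⟨κ, lt_of_le_of_ne ?_ ?_, h1⟩
  -- The diagonal entry κ (c a)² of the adjugate is a principal minor of a positive semidefinite
  -- matrix, hence nonnegative.
  · obtain ⟨a, ha⟩ : ∃ a, c a p ≠ 0 := by
      by_contra! h
      exact hR0 (by rw [hRc.self_of_nhds]; simp [h])
    have h3 := adjugate_diag_nonneg (posSemidef_gram hg.symm (nonneg_of_mem_singularSet hg hp) E) a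
    rw [h2, mul_assoc] at h3
    exact nonneg_of_mul_nonneg_left h3 (mul_self_pos.2 ha)
  · rintro rfl
    exact detForm_ne_zero hrad hp hRp hR0 (by simpa using h1 R)

theorem mem_tangentSigma_iff_dirDeriv (hg : IsTransverseRiemannLorentz g)
    (hrad : HasTransverseRadical g) (hp : p ∈ singularSet g) {R : VField (n + 1) M}
    (hR : IsRadicalVField g R) {X : VField (n + 1) M} :
    X p ∈ tangentSigma g p ↔ dirDeriv X (fun x => g x (R x) (R x)) p = 0 := by
  obtain ⟨κ, hκ, h⟩ := exists_pos_detForm_eq_mul hg hrad hp hR.1 (hR.2 p hp).1 (hR.2 p hp).2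
  rw [mem_tangentSigma_iff, h X, mul_eq_zero, or_iff_right hκ.ne']

theorem dirDeriv_radical_ne_zero (hg : IsTransverseRiemannLorentz g)
    (hrad : HasTransverseRadical g) (hp : p ∈ singularSet g) {R : VField (n + 1) M}
    (hR : IsRadicalVField g R) : dirDeriv R (fun x => g x (R x) (R x)) p ≠ 0 := fun h =>
  detForm_ne_zero hrad hp (hR.2 p hp).1 (hR.2 p hp).2
    (mem_tangentSigma_iff.1 ((mem_tangentSigma_iff_dirDeriv hg hrad hp hR).2 h))

theorem exists_radical_pos_nhds (hg : IsTransverseRiemannLorentz g)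
    (hrad : HasTransverseRadical g) (p : M) :
    ∃ V : VField (n + 1) M, IsSmoothVField V ∧
      ∀ᶠ x in 𝓝 p, x ∈ singularSet g → V x ∈ radical g x ∧ 0 < detForm g x (V x) := by
  by_cases hp : p ∈ singularSet g
  · obtain ⟨E, hE, hEc, hb, hcoef⟩ := exists_isSmoothVField_frame (d := n + 1) p
    obtain ⟨b, hbp⟩ := hb.self_of_nhds
    have hdet := (mem_singularSet_iff_det hg.symm hbp).1 hp
    obtain ⟨r, hr0, hr⟩ := mem_singularSet_iff.1 hp
    obtain ⟨R, hR, rfl⟩ := exists_isSmoothVField_apply_eq p r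
    obtain ⟨c, hc, hRc⟩ := hcoef R hR
    obtain ⟨κ, h1, h2⟩ :=
      exists_detForm_eq_mul hg.smooth hg.symm hrad hp hR hr hr0 hE hEc hbp hc hRc
    have hκ : κ ≠ 0 := by
      rintro rfl
      exact detForm_ne_zero hrad hp hr hr0 (by simpa using h1 R)
    obtain ⟨a, ha⟩ : ∃ a, c a p ≠ 0 := by
      by_contra! h
      exact hr0 (by rw [hRc.self_of_nhds]; simp [h])
    -- Column a of the adjugate is radical at every nearby point of Σ, and at p it equals κ (c a) R,
    -- which is nonzero. The scalar s fixes the sign; the choice below makes d det(W) at p the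
    -- square of d det(R).
    have hW : ∀ s : ℝ, IsSmoothVField fun x => ∑ e, ((fun x =>
        s * (gram g E x).adjugate e a) • E e) x := fun s =>
      IsSmoothVField.sum fun e =>
        (hE e).smul (contMDiff_const.mul (contMDiff_gram_adjugate hg.smooth hE e a))
    set W : ℝ → VField (n + 1) M := fun s x => ∑ e, ((fun x =>
        s * (gram g E x).adjugate e a) • E e) x with hWdef
    have hWs : ∀ s x, W s x = s • ∑ e, (gram g E x).adjugate e a • E e x := fun s x => by
      simp only [hWdef, Finset.smul_sum, smul_smul]
      rfl
    have hWp : ∀ s, W s p = (s * (κ * c a p)) • R p := fun s => by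
      rw [hWs, mul_smul]
      congr 1
      rw [hRc.self_of_nhds, Finset.smul_sum]
      refine Finset.sum_congr rfl fun e _ => ?_
      rw [h2, smul_smul]
      congr 1
      ring
    obtain ⟨s, hs⟩ : ∃ s, 0 < detForm g p (W s p) := by
      refine ⟨(κ * c a p)⁻¹ * detForm g p (R p), ?_⟩
      rw [hWp, map_smul, smul_eq_mul]
      have h3 := mul_self_pos.2 (detForm_ne_zero hrad hp hr hr0)
      refine h3.trans_eq ?_
      field_simp
    have hrW : ∀ᶠ x in 𝓝 p, x ∈ singularSet g → W s x ∈ radical g x := by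
      filter_upwards [hb] with x ⟨b, hb⟩ hx
      rw [hWs]
      exact Submodule.smul_mem _ _ (sum_adjugate_smul_mem_radical hg.symm hb
        ((mem_singularSet_iff_det hg.symm hb).1 hx) a)
    have hne : ∀ {x : M}, x ∈ singularSet g → W s x ∈ radical g x → W s x ≠ 0 →
        ∃ κ > 0, detForm g x (W s x) =
          κ * dirDeriv (W s) (fun x => g x (W s x) (W s x)) x := fun hx h h0 => by
      obtain ⟨κ, hκ, h⟩ := exists_pos_detForm_eq_mul hg hrad hx (hW s) h h0
      exact ⟨κ, hκ, h _⟩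
    -- `detForm g x` is taken in a chart depending on x, so its continuity in x is not available.
    -- Its sign on W agrees with that of W(g(W, W)), which is continuous; this is where κ > 0 is
    -- needed.
    have hcont : Continuous (dirDeriv (W s) (fun x => g x (W s x) (W s x))) :=
      (contMDiff_dirDeriv (hW s) (hg.smooth.contMDiff_apply (hW s) (hW s))).continuous
    have hpos : 0 < dirDeriv (W s) (fun x => g x (W s x) (W s x)) p := by
      obtain ⟨κ, hκ, h⟩ := hne hp (hrW.self_of_nhds hp) (fun h0 => by
        rw [h0, map_zero] at hs; exact hs.false)
      rw [h] at hs
      exact (mul_pos_iff_of_pos_left hκ).1 hs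
    refine ⟨W s, hW s, ?_⟩
    filter_upwards [hrW, hcont.continuousAt.eventually (lt_mem_nhds hpos)] with x h3 h4 hx
    obtain ⟨κ, hκ, h⟩ := hne hx (h3 hx) (fun h0 => by
      exact h4.ne' ((dirDeriv_congr_field (Y := 0) h0).trans (map_zero _)))
    exact ⟨h3 hx, h ▸ mul_pos hκ h4⟩
  · refine ⟨0, contMDiff_zeroSection _ _, ?_⟩
    filter_upwards [(isOpen_regularPart hg.smooth hg.symm).mem_nhds hp] with x hx h
    exact (hx h).elim

theorem exists_isRadicalVField (hg : IsTransverseRiemannLorentz g)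
    (hrad : HasTransverseRadical g) : ∃ R, IsRadicalVField g R := by
  obtain ⟨R, hR, h⟩ := exists_isSmoothVField_forall_mem (d := n + 1) (M := M)
    (fun x => {v | x ∈ singularSet g → v ∈ radical g x ∧ 0 < detForm g x v})
    (convex_radical_pos g) (exists_radical_pos_nhds hg hrad)
  exact ⟨R, hR, fun p hp => ⟨(h p hp).1, fun h0 => by
      have := (h p hp).2
      rw [h0, map_zero] at this
      exact this.false⟩⟩

end RadicalFields

/-! ### Flatness of the regular part implies II-flatness and III-flatness. -/

section Flatness

theorem eq_of_dense_of_eventually {α β : Type*} [TopologicalSpace α] [TopologicalSpace β]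
    [T2Space β] {s : Set α} (hs : Dense s) {f h : α → β} {p : α} (hf : ContinuousAt f p)
    (hh : ContinuousAt h p) (H : ∀ᶠ x in 𝓝 p, x ∈ s → f x = h x) : f p = h p := by
  have : (𝓝[s] p).NeBot := mem_closure_iff_nhdsWithin_neBot.1 (hs p)
  exact tendsto_nhds_unique_of_eventuallyEq (hf.tendsto.mono_left nhdsWithin_le_nhds)
    (hh.tendsto.mono_left nhdsWithin_le_nhds) (eventually_nhdsWithin_iff.2 H)

variable {n : ℕ} {M : Type*} [TopologicalSpace M]
  [ChartedSpace (EuclideanSpace ℝ (Fin (n + 1))) M] [IsManifold (𝓡 (n + 1)) ∞ M]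
  {g : BilinField (n + 1) M} {p : M} {R X Y Z A V : VField (n + 1) M}

theorem apply_radical (hg : IsTransverseRiemannLorentz g) (hp : p ∈ singularSet g)
    (hR : IsRadicalVField g R) (v : TangentSpace (𝓡 (n + 1)) p) : g p v (R p) = 0 := by
  rw [hg.symm, show g p (R p) = 0 from (hR.2 p hp).1]
  rfl

/-- The torsion identity contributes g([X, Y], R), which vanishes on Σ. -/
theorem dualConn_swap_of_radical (hg : IsTransverseRiemannLorentz g) (hp : p ∈ singularSet g)
    (hR : IsRadicalVField g R) : dualConn g X Y R p = dualConn g Y X R p := by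
  have := dualConn_sub_swap (X := X) (Y := Y) (Z := R) (p := p) hg.symm
  rw [apply_radical hg hp hR] at this
  linarith

variable [T2Space M] [SecondCountableTopology M]

theorem exists_isNablaExtension (hg : IsTransverseRiemannLorentz g)
    (hrad : HasTransverseRadical g) (hR : IsRadicalVField g R) (hX : IsSmoothVField X)
    (hY : IsSmoothVField Y) (hK : ∀ p ∈ singularSet g, dualConn g X Y R p = 0) :
    ∃ V, IsNablaExtension g X Y V := by
  -- The condition at x is a single value on 𝕄 and empty on Σ, hence convex, so local extensions
  -- glue.
  refine exists_isSmoothVField_forall_mem (d := n + 1) (M := M)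
    (fun x => {v | x ∈ regularPart g → v = nabla g X Y x}) ?_ fun p => ?_
  · intro x v hv w hw a b _ _ hab hx
    rw [hv hx, hw hx, ← add_smul, hab, one_smul]
  · refine exists_nabla_extension_nhds hg.smooth hg.symm (hg.transverse p) hX hY
      (.of_forall fun x hx Z hZ hZx => ?_)
    obtain ⟨c, hc⟩ : ∃ c : ℝ, Z x = c • R x :=
      ⟨_, eq_smul_of_mem_radical hrad hx (hR.2 x hx).1 (hR.2 x hx).2 hZx⟩
    rw [dualConn_congr_right hg.smooth hg.symm hX hY hZ (hR.1.const_smul c) hc]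
    have h := dualConn_smul_right (p := x) hg.smooth hg.symm hX hY (f := fun _ => c)
      contMDiff_const hR.1
    refine h.trans ?_
    rw [hK x hx, mul_zero]

theorem IsNablaExtension.apply_eq (hV : IsNablaExtension g X Y V)
    (hg : IsTransverseRiemannLorentz g) (hX : IsSmoothVField X)
    (hY : IsSmoothVField Y) (hZ : IsSmoothVField Z) (p : M) :
    g p (V p) (Z p) = dualConn g X Y Z p := by
  refine congrFun (Continuous.ext_on (dense_regularPart hg)
    (hg.smooth.contMDiff_apply hV.1 hZ).continuous
    (contMDiff_dualConn hg.smooth hX hY hZ).continuous fun x hx => ?_) p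
  rw [hV.2 x hx, apply_nabla hg.smooth hg.symm hx hX hY hZ]

theorem IsNablaExtension.eventuallyEq (hV : IsNablaExtension g X Y V)
    (hg : IsTransverseRiemannLorentz g) (hp : p ∈ regularPart g) : nabla g X Y =ᶠ[𝓝 p] V := by
  filter_upwards [(isOpen_regularPart hg.smooth hg.symm).mem_nhds hp] with x hx
  exact (hV.2 x hx).symm

/-- Exchanging R and Y gives □_Y R(R) = Y g(R, R) / 2, zero for tangent Y. Hence ∇_R Y extends
across Σ without any curvature assumption. -/
theorem dualConn_radical_left (hg : IsTransverseRiemannLorentz g) (hrad : HasTransverseRadical g)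
    (hp : p ∈ singularSet g) (hR : IsRadicalVField g R) (hY : IsTangentToSigma g Y) :
    dualConn g R Y R p = 0 := by
  rw [dualConn_swap_of_radical hg hp hR, dualConn_self_right hg.symm,
    (mem_tangentSigma_iff_dirDeriv hg hrad hp hR).1 (hY.2 p hp), zero_div]

theorem isIIFlat_of_isFlatOn (hg : IsTransverseRiemannLorentz g) (hrad : HasTransverseRadical g)
    (hflat : IsFlatOn g (regularPart g)) (hR : IsRadicalVField g R) (hX : IsTangentToSigma g X)
    (hZ : IsTangentToSigma g Z) (hp : p ∈ singularSet g) : dualConn g X Z R p = 0 := by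
  have hs := hg.symm
  obtain ⟨U, hU⟩ := exists_isNablaExtension hg hrad hR hR.1 hZ.1
    fun q hq => dualConn_radical_left hg hrad hq hR hZ
  obtain ⟨E, hE, hEc, hb, hcoef⟩ := exists_isSmoothVField_frame (d := n + 1) p
  obtain ⟨b, hbp⟩ := hb.self_of_nhds
  obtain ⟨c, hc, hRc⟩ := hcoef R hR.1
  obtain ⟨κ, h1, h2⟩ := exists_detForm_eq_mul hg.smooth hs hrad hp hR.1 (hR.2 p hp).1
    (hR.2 p hp).2 hE hEc hbp hc hRc
  have hκ : κ ≠ 0 := by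
    rintro rfl
    exact detForm_ne_zero hrad hp (hR.2 p hp).1 (hR.2 p hp).2 (by simpa using h1 R)
  have hRs := hR.1
  have hXs := hX.1
  have hZs := hZ.1
  have hXR := hXs.mlieBracket hRs
  have hD := contMDiff_gram_det hg.smooth hE
  have hA := contMDiff_gram_adjugate hg.smooth hE
  have hθ := fun a => contMDiff_dualConn hg.smooth hXs hZs (hE a)
  have hρ := fun a => contMDiff_dualConn hg.smooth hRs hRs (hE a)
  have hXZR := contMDiff_dualConn hg.smooth hXs hZs hRs
  -- On 𝕄 the left side is det · □_R R(∇_X Z) by Cramer's rule, and flatness with metric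
  -- compatibility identifies the bracket on the right with □_R R(∇_X Z). Both sides are continuous
  -- on M although ∇_X Z is not yet known to extend, so the identity reaches Σ.
  have key : ∑ a, ∑ e, (gram g E p).adjugate a e * dualConn g X Z (E e) p
        * dualConn g R R (E a) p
      = (gram g E p).det * (dirDeriv R (dualConn g X Z R) p - dualConn g X U R p
        + dualConn g (mlieBracket (𝓡 (n + 1)) X R) Z R p) := by
    refine eq_of_dense_of_eventually (dense_regularPart hg)
      (f := fun p => ∑ a, ∑ e, (gram g E p).adjugate a e * dualConn g X Z (E e) p
        * dualConn g R R (E a) p)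
      (h := fun p => (gram g E p).det * (dirDeriv R (dualConn g X Z R) p - dualConn g X U R p
        + dualConn g (mlieBracket (𝓡 (n + 1)) X R) Z R p))
      (contMDiff_finsetSum fun a _ => contMDiff_finsetSum fun e _ =>
        ((hA a e).mul (hθ e)).mul (hρ a)).continuous.continuousAt
      (hD.mul (((contMDiff_dirDeriv hRs hXZR).sub
        (contMDiff_dualConn hg.smooth hXs hU.1 hRs)).add
        (contMDiff_dualConn hg.smooth hXR hZs hRs))).continuous.continuousAt ?_
    filter_upwards [hb] with x ⟨b, hb⟩ hx
    obtain ⟨B, hB, hBe⟩ := exists_nabla_eventuallyEq hg.smooth hs hx hXs hZs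
    have h3 := covCurvature_eq hg.smooth hs hx hXs hRs hZs hRs hU.1 hB
      (hU.eventuallyEq hg hx) hBe
    rw [hflat X R Z R hXs hRs hZs hRs x hx] at h3
    have h4 : ∀ᶠ y in 𝓝 x, ∀ T : VField (n + 1) M, IsSmoothVField T →
        g y (B y) (T y) = dualConn g X Z T y := by
      filter_upwards [hBe, (isOpen_regularPart hg.smooth hs).mem_nhds hx] with y h5 h6 T hT
      rw [← h5, apply_nabla hg.smooth hs h6 hXs hZs hT]
    have h5 := dualConn_add_swap (X := R) (Y := B) (Z := R) (p := x) hs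
    rw [dirDeriv_congr (h4.mono fun y hy => hy R hRs)] at h5
    have hBx : B x = ∑ a, b.repr (B x) a • E a x := by
      simp only [← hb]
      exact (b.sum_repr _).symm
    have h6 : dualConn g R R B x = ∑ a, b.repr (B x) a * dualConn g R R (E a) x := by
      rw [dualConn_congr_right hg.smooth hs hRs hRs hB (IsSmoothVField.sum fun a =>
        (hE a).const_smul (b.repr (B x) a)) hBx]
      exact dualConn_sum_right (p := x) hg.smooth hs hRs hRs (c := fun a _ => b.repr (B x) a)
        (fun a => contMDiff_const) hE
    have h7 : ∀ a, ∑ e, (gram g E x).adjugate a e * dualConn g X Z (E e) x =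
        (gram g E x).det * b.repr (B x) a := by
      intro a
      have h8 : ∀ e, dualConn g X Z (E e) x = (gram g E x).mulVec (b.repr (B x)) e := by
        intro e
        rw [← h4.self_of_nhds _ (hE e), hs]
        conv_lhs => rw [hBx]
        rw [apply_sum_right]
        simp [Matrix.mulVec, dotProduct, gram_apply, mul_comm]
      have h9 := congrFun (congrArg (fun B' => B'.mulVec (b.repr (B x)))
        (Matrix.adjugate_mul (gram g E x))) a
      simp only [← Matrix.mulVec_mulVec] at h9
      simp only [h8]
      refine Eq.trans ?_ (h9.trans ?_)
      · rfl
      · simp [Matrix.smul_mulVec]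
    have h10 : dirDeriv R (dualConn g X Z R) x - dualConn g X U R x
        + dualConn g (mlieBracket (𝓡 (n + 1)) X R) Z R x = dualConn g R R B x := by linarith
    rw [h10, h6, Finset.mul_sum]
    refine Finset.sum_congr rfl fun a _ => ?_
    rw [← Finset.sum_mul, h7, mul_assoc]
  rw [(mem_singularSet_iff_det hs hbp).1 hp, zero_mul] at key
  have h3 : ∀ {X Y : VField (n + 1) M}, IsSmoothVField X → IsSmoothVField Y →
      dualConn g X Y R p = ∑ e, c e p * dualConn g X Y (E e) p := fun hX hY => by
    refine (dualConn_congr (.refl _ _) (.refl _ _) hRc).trans ?_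
    exact dualConn_sum_right hg.smooth hs hX hY hc hE
  -- At p the determinant is zero and the adjugate is κ c ⊗ c, so contraction with c turns both
  -- covectors into their values on R.
  have h4 : κ * dualConn g X Z R p * dualConn g R R R p = 0 := by
    rw [h3 hXs hZs, h3 hRs hRs, ← key, Finset.mul_sum, Finset.mul_sum]
    refine Finset.sum_congr rfl fun a _ => ?_
    rw [Finset.sum_mul]
    refine Finset.sum_congr rfl fun e _ => ?_
    rw [h2]
    ring
  have h5 : dualConn g R R R p ≠ 0 := by
    rw [dualConn_self_right hs]
    exact div_ne_zero (dirDeriv_radical_ne_zero hg hrad hp hR) two_ne_zero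
  simpa [hκ, h5] using h4

/-- With f = g(R, R), the field W = (R f) Z − (Z f) R kills f on Σ and so is tangent there. Metric
compatibility and II-flatness give □_X R(W) = 0, and □_X R(R) = X f / 2 = 0; since R f ≠ 0 on Σ, □_X
R(Z) = 0. -/
theorem dualConn_radical_right_eq_zero (hg : IsTransverseRiemannLorentz g)
    (hrad : HasTransverseRadical g) (hII : IsIIFlat g) (hR : IsRadicalVField g R)
    (hX : IsTangentToSigma g X) (hZ : IsSmoothVField Z) (hp : p ∈ singularSet g) :
    dualConn g X R Z p = 0 := by
  have hs := hg.symm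
  set f : M → ℝ := fun x => g x (R x) (R x) with hf
  have hfs : ContMDiff (𝓡 (n + 1)) 𝓘(ℝ, ℝ) ∞ f := hg.smooth.contMDiff_apply hR.1 hR.1
  have hRf := contMDiff_dirDeriv hR.1 hfs
  have hZf := contMDiff_dirDeriv hZ hfs
  have hZf' : ContMDiff (𝓡 (n + 1)) 𝓘(ℝ, ℝ) ∞ fun x => -dirDeriv Z f x := hZf.neg
  set W : VField (n + 1) M := dirDeriv R f • Z + (fun x => -dirDeriv Z f x) • R with hWdef
  have hWs : IsSmoothVField W := (hZ.smul hRf).add (hR.1.smul hZf')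
  have hW : IsTangentToSigma g W := by
    refine ⟨hWs, fun q hq => (mem_tangentSigma_iff_dirDeriv hg hrad hq hR).2 ?_⟩
    rw [hWdef, dirDeriv_field_add, dirDeriv_field_smul, dirDeriv_field_smul]
    ring
  have h1 := dualConn_add_swap (X := X) (Y := R) (Z := W) (p := p) hs
  rw [show dualConn g X W R p = 0 from hII.2 R hR X W hX hW p hp,
    dirDeriv_eq_zero_of_mem_tangentSigma hg.smooth hs hp (hg.transverse p hp)
      (hg.smooth.contMDiff_apply hR.1 hWs) (fun q hq => by
        rw [hs]; exact apply_radical hg hq hR _) (hX.2 p hp), hWdef,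
    dualConn_add_right hg.smooth hs hX.1 hR.1 (hZ.smul hRf) (hR.1.smul hZf'),
    dualConn_smul_right hg.smooth hs hX.1 hR.1 hRf hZ,
    dualConn_smul_right hg.smooth hs hX.1 hR.1 hZf' hR.1, dualConn_self_right hs,
    (mem_tangentSigma_iff_dirDeriv hg hrad hp hR).1 (hX.2 p hp)] at h1
  have h2 := dirDeriv_radical_ne_zero hg hrad hp hR
  simpa [hf, h2] using h1

/-- Extends II-flatness to fields A that need not be tangent: □_A Y(R) = □_Y A(R) on Σ, and metric
compatibility trades it for −□_Y R(A), because g(A, R) vanishes on Σ. -/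
theorem dualConn_tangent_eq_zero (hg : IsTransverseRiemannLorentz g)
    (hrad : HasTransverseRadical g) (hII : IsIIFlat g) (hR : IsRadicalVField g R)
    (hY : IsTangentToSigma g Y) (hA : IsSmoothVField A) (hp : p ∈ singularSet g) :
    dualConn g A Y R p = 0 := by
  have h1 := dualConn_add_swap (X := Y) (Y := A) (Z := R) (p := p) hg.symm
  rw [dualConn_radical_right_eq_zero hg hrad hII hR hY hA hp,
    dirDeriv_eq_zero_of_mem_tangentSigma hg.smooth hg.symm hp (hg.transverse p hp)
      (hg.smooth.contMDiff_apply hA hR.1) (fun q hq => apply_radical hg hq hR _)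
      (hY.2 p hp)] at h1
  rw [dualConn_swap_of_radical hg hp hR]
  linarith

/-- Extensions of covariant derivatives of tangent fields are tangent. -/
theorem IsNablaExtension.isTangentToSigma (hV : IsNablaExtension g X Y V)
    (hg : IsTransverseRiemannLorentz g) (hrad : HasTransverseRadical g)
    (hflat : IsFlatOn g (regularPart g)) (hII : IsIIFlat g)
    (hX : IsTangentToSigma g X) (hY : IsTangentToSigma g Y) : IsTangentToSigma g V := by
  obtain ⟨R, hR⟩ := hII.1
  refine ⟨hV.1, fun p hp => (mem_tangentSigma_iff_dirDeriv hg hrad hp hR).2 ?_⟩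
  have hs := hg.symm
  obtain ⟨U, hU⟩ := exists_isNablaExtension hg hrad hR hR.1 hY.1
    fun q hq => dualConn_radical_left hg hrad hq hR hY
  have hXR := hX.1.mlieBracket hR.1
  -- This is K(X, R, Y, R) = 0 continued to Σ, now that both covariant derivatives have smooth
  -- extensions. The first and third terms vanish by the two preceding lemmas, leaving □_R V(R) = V
  -- g(R, R) / 2.
  have key : dualConn g X U R p - dualConn g R V R p
      - dualConn g (mlieBracket (𝓡 (n + 1)) X R) Y R p = 0 := by
    refine eq_of_dense_of_eventually (dense_regularPart hg)
      (f := fun p => dualConn g X U R p - dualConn g R V R p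
        - dualConn g (mlieBracket (𝓡 (n + 1)) X R) Y R p) (h := fun _ => (0 : ℝ))
      (((contMDiff_dualConn hg.smooth hX.1 hU.1 hR.1).sub
        (contMDiff_dualConn hg.smooth hR.1 hV.1 hR.1)).sub
        (contMDiff_dualConn hg.smooth hXR hY.1 hR.1)).continuous.continuousAt
      continuousAt_const (.of_forall fun x hx => ?_)
    rw [← hflat X R Y R hX.1 hR.1 hY.1 hR.1 x hx]
    exact (covCurvature_eq hg.smooth hs hx hX.1 hR.1 hY.1 hR.1 hU.1 hV.1
      (hU.eventuallyEq hg hx) (hV.eventuallyEq hg hx)).symm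
  have h1 := dualConn_add_swap (X := X) (Y := U) (Z := R) (p := p) hs
  rw [dualConn_radical_right_eq_zero hg hrad hII hR hX hU.1 hp,
    dirDeriv_eq_zero_of_mem_tangentSigma hg.smooth hs hp (hg.transverse p hp)
      (hg.smooth.contMDiff_apply hU.1 hR.1) (fun q hq => apply_radical hg hq hR _)
      (hX.2 p hp)] at h1
  rw [dualConn_tangent_eq_zero hg hrad hII hR hY hXR hp,
    dualConn_swap_of_radical (X := R) (Y := V) hg hp hR, dualConn_self_right hs] at key
  linarith

theorem isIIIFlat_of_isFlatOn (hg : IsTransverseRiemannLorentz g) (hrad : HasTransverseRadical g)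
    (hflat : IsFlatOn g (regularPart g)) : IsIIIFlat g := by
  have hII : IsIIFlat g := ⟨exists_isRadicalVField hg hrad,
    fun R hR X Y hX hY p hp => isIIFlat_of_isFlatOn hg hrad hflat hR hX hY hp⟩
  refine ⟨hII, fun R hR X Y hX hY => ?_⟩
  obtain ⟨V, hV⟩ := exists_isNablaExtension hg hrad hR hX.1 hY.1
    fun q hq => hII.2 R hR X Y hX hY q hq
  refine ⟨V, hV, fun p hp => ?_⟩
  rw [II, dualConn_self_right hg.symm, (mem_tangentSigma_iff_dirDeriv hg hrad hp hR).1
    ((hV.isTangentToSigma hg hrad hflat hII hX hY).2 p hp), zero_div]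

end Flatness

/-! ### Σ as an embedded hypersurface. -/

section Slices

theorem exists_equiv_prod_of_ne_zero {n : ℕ} {ℓ : EuclideanSpace ℝ (Fin (n + 1)) →L[ℝ] ℝ}
    (hℓ : ℓ ≠ 0) : ∃ L : (EuclideanSpace ℝ (Fin n) × ℝ) ≃L[ℝ] EuclideanSpace ℝ (Fin (n + 1)),
      ∀ u, ℓ (L u) = u.2 := by
  have hℓ' : (ℓ : EuclideanSpace ℝ (Fin (n + 1)) →ₗ[ℝ] ℝ) ≠ 0 := fun h =>
    hℓ (ContinuousLinearMap.coe_injective h)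
  obtain ⟨v, hv⟩ : ∃ v, ℓ v = 1 := LinearMap.surjective hℓ' 1
  have hk := Module.Dual.finrank_ker_add_one_of_ne_zero hℓ'
  rw [finrank_euclideanSpace, Fintype.card_fin, add_left_inj] at hk
  let ι : EuclideanSpace ℝ (Fin n) ≃ₗ[ℝ] LinearMap.ker ℓ.toLinearMap :=
    LinearEquiv.ofFinrankEq _ _ (by simpa using hk.symm)
  let T : EuclideanSpace ℝ (Fin n) × ℝ →ₗ[ℝ] EuclideanSpace ℝ (Fin (n + 1)) :=
    ((LinearMap.ker ℓ.toLinearMap).subtype ∘ₗ ι.toLinearMap).coprod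
      (LinearMap.toSpanSingleton ℝ _ v)
  have hT : ∀ u, ℓ (T u) = u.2 := fun u => by
    have h : ℓ (ι u.1) = 0 := (ι u.1).2
    simp [T, h, hv]
  have hinj : Function.Injective T := by
    rw [← LinearMap.ker_eq_bot, Submodule.eq_bot_iff]
    rintro ⟨u, t⟩ h
    have h1 : T (u, t) = 0 := h
    have h2 : t = 0 := by simpa [h1] using (hT (u, t)).symm
    subst h2
    have h3 : ((ι u : LinearMap.ker ℓ.toLinearMap) : EuclideanSpace ℝ (Fin (n + 1))) = 0 := by
      simpa [T] using h1
    have h4 : u = 0 := by simpa using h3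
    rw [h4]
    rfl
  exact ⟨(LinearEquiv.ofInjectiveOfFinrankEq T hinj (by simp)).toContinuousLinearEquiv,
    fun u => hT u⟩

variable {n : ℕ} {M : Type*} [TopologicalSpace M] {S : Set M}

/-- The chart of a subset cut out, in a chart `ψ`, by the vanishing of a linear form. -/
theorem exists_sliceChart {ψ : OpenPartialHomeomorph M (EuclideanSpace ℝ (Fin (n + 1)))}
    {ℓ : EuclideanSpace ℝ (Fin (n + 1)) →L[ℝ] ℝ} (hℓ : ℓ ≠ 0)
    (hS : ∀ x ∈ ψ.source, x ∈ S ↔ ℓ (ψ x) = 0) (p : S) :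
    ∃ (φ : OpenPartialHomeomorph S (EuclideanSpace ℝ (Fin n)))
      (L : (EuclideanSpace ℝ (Fin n) × ℝ) ≃L[ℝ] EuclideanSpace ℝ (Fin (n + 1))),
      φ.source = Subtype.val ⁻¹' ψ.source ∧ ∀ s ∈ φ.source, ψ s = L (φ s, 0) := by
  classical
  obtain ⟨L, hL⟩ := exists_equiv_prod_of_ne_zero hℓ
  have h1 : ∀ s : S, (s : M) ∈ ψ.source → L ((L.symm (ψ s)).1, 0) = ψ s := fun s hs => by
    have h2 := hL (L.symm (ψ s))
    rw [L.apply_symm_apply, (hS s hs).1 s.2] at h2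
    rw [h2, Prod.mk.eta, L.apply_symm_apply]
  have h2 : ∀ u, L (u, 0) ∈ ψ.target → ψ.symm (L (u, 0)) ∈ S := fun u hu => by
    rw [hS _ (ψ.map_target hu), ψ.right_inv hu, hL]
  let inv : EuclideanSpace ℝ (Fin n) → S := fun u =>
    if h : ψ.symm (L (u, 0)) ∈ S then ⟨_, h⟩ else p
  have hinv : ∀ u, L (u, 0) ∈ ψ.target → (inv u : M) = ψ.symm (L (u, 0)) := fun u hu => by
    simp only [inv, dif_pos (h2 u hu)]
  let φ : OpenPartialHomeomorph S (EuclideanSpace ℝ (Fin n)) :=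
    { toFun := fun s => (L.symm (ψ s)).1
      invFun := inv
      source := Subtype.val ⁻¹' ψ.source
      target := {u | L (u, 0) ∈ ψ.target}
      map_source' := fun s hs => by
        change L ((L.symm (ψ s)).1, 0) ∈ ψ.target
        rw [h1 s hs]
        exact ψ.map_source hs
      map_target' := fun u hu => by
        change (inv u : M) ∈ ψ.source
        rw [hinv u hu]
        exact ψ.map_target hu
      left_inv' := fun s hs => by
        have h3 : L ((L.symm (ψ s)).1, 0) ∈ ψ.target := by
          rw [h1 s hs]; exact ψ.map_source hs
        apply Subtype.ext
        rw [hinv _ h3, h1 s hs, ψ.left_inv hs]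
      right_inv' := fun u hu => by
        rw [hinv u hu, ψ.right_inv hu, L.symm_apply_apply]
      open_source := ψ.open_source.preimage continuous_subtype_val
      open_target := ψ.open_target.preimage
        (L.continuous.comp (continuous_id.prodMk continuous_const))
      continuousOn_toFun := continuous_fst.comp_continuousOn (L.symm.continuous.comp_continuousOn
        (ψ.continuousOn.comp continuous_subtype_val.continuousOn fun s hs => hs))
      continuousOn_invFun := by
        rw [Topology.IsInducing.subtypeVal.continuousOn_iff]
        refine (ψ.continuousOn_symm.comp (L.continuous.comp
          (continuous_id.prodMk continuous_const)).continuousOn fun u hu => hu).congr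
          fun u hu => hinv u hu }
  exact ⟨φ, L, rfl, fun s hs => (h1 s hs).symm⟩

variable [ChartedSpace (EuclideanSpace ℝ (Fin (n + 1))) M]

/-- A subset which is locally, in suitable charts, the zero set of a nonzero linear form is an
embedded hypersurface. -/
theorem exists_isSmoothEmbedding_of_slices
    (H : ∀ p ∈ S, ∃ ψ ∈ IsManifold.maximalAtlas (𝓡 (n + 1)) ∞ M, p ∈ ψ.source ∧
      ∃ ℓ : EuclideanSpace ℝ (Fin (n + 1)) →L[ℝ] ℝ, ℓ ≠ 0 ∧
        ∀ x ∈ ψ.source, x ∈ S ↔ ℓ (ψ x) = 0) :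
    ∃ cs : ChartedSpace (EuclideanSpace ℝ (Fin n)) S, IsManifold (𝓡 n) ∞ S ∧
      Manifold.IsSmoothEmbedding (𝓡 n) (𝓡 (n + 1)) ∞ (Subtype.val : S → M) := by
  have H' : ∀ p : S, ∃ ψ ∈ IsManifold.maximalAtlas (𝓡 (n + 1)) ∞ M, (p : M) ∈ ψ.source ∧
      ∃ (φ : OpenPartialHomeomorph S (EuclideanSpace ℝ (Fin n)))
      (L : (EuclideanSpace ℝ (Fin n) × ℝ) ≃L[ℝ] EuclideanSpace ℝ (Fin (n + 1))),
      φ.source = Subtype.val ⁻¹' ψ.source ∧ ∀ s ∈ φ.source, ψ s = L (φ s, 0) := fun p => by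
    obtain ⟨ψ, h1, h2, ℓ, h3, h4⟩ := H p p.2
    exact ⟨ψ, h1, h2, exists_sliceChart h3 h4 p⟩
  choose ψ hψ hpψ φ L hsrc hφ using H'
  let _cs : ChartedSpace (EuclideanSpace ℝ (Fin n)) S :=
    { atlas := Set.range φ
      chartAt := φ
      mem_chart_source := fun p => by rw [hsrc]; exact hpψ p
      chart_mem_atlas := fun p => Set.mem_range_self p }
  have hman : IsManifold (𝓡 n) ∞ S := by
    refine isManifold_of_contDiffOn _ _ _ ?_
    rintro _ _ ⟨p, rfl⟩ ⟨q, rfl⟩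
    have hc : ContDiffOn ℝ ∞ ((ψ p).symm.trans (ψ q)) ((ψ p).symm.trans (ψ q)).source :=
      contMDiffOn_iff_contDiffOn.1 (contMDiffOn_of_mem_contDiffGroupoid
        (IsManifold.compatible_of_mem_maximalAtlas (hψ p) (hψ q)))
    have hsym : ∀ u ∈ (φ p).target, (ψ p).symm (L p (u, 0)) = (φ p).symm u := fun u hu => by
      have h1 := (φ p).map_target hu
      have h2 := hφ p _ h1
      rw [hsrc] at h1
      rw [(φ p).right_inv hu] at h2
      rw [← h2, (ψ p).left_inv h1]
    have hq : ∀ s ∈ (φ q).source, φ q s = ((L q).symm (ψ q s)).1 := fun s hs => by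
      rw [hφ q s hs, (L q).symm_apply_apply]
    simp only [modelWithCornersSelf_coe, modelWithCornersSelf_coe_symm, Set.range_id,
      Set.inter_univ, Set.preimage_id, Function.comp_id, Function.id_comp]
    -- Transition maps of Σ are ambient transition maps restricted to the slice and projected back
    -- to it.
    have hcomp : ContDiffOn ℝ ∞ (fun u => ((L q).symm
        (((ψ p).symm.trans (ψ q)) (L p (u, 0)))).1) ((φ p).symm.trans (φ q)).source := by
      refine contDiff_fst.comp_contDiffOn ((L q).symm.contDiff.comp_contDiffOn
        (hc.comp ((L p).contDiff.comp (contDiff_id.prodMk contDiff_const)).contDiffOn ?_))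
      intro u hu
      rw [OpenPartialHomeomorph.trans_source] at hu ⊢
      have h1 : u ∈ (φ p).target := hu.1
      have h2 : (φ p).symm u ∈ (φ q).source := hu.2
      have h3 := (φ p).map_target h1
      refine ⟨?_, ?_⟩
      · change L p (u, 0) ∈ (ψ p).target
        rw [← (φ p).right_inv h1, ← hφ p _ h3]
        rw [hsrc] at h3
        exact (ψ p).map_source h3
      · change (ψ p).symm (L p (u, 0)) ∈ (ψ q).source
        rw [hsym u h1]
        rwa [hsrc] at h2
    refine hcomp.congr fun u hu => ?_
    rw [OpenPartialHomeomorph.trans_source] at hu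
    have h1 : u ∈ (φ p).target := hu.1
    have h2 : (φ p).symm u ∈ (φ q).source := hu.2
    change φ q ((φ p).symm u) = ((L q).symm (ψ q ((ψ p).symm (L p (u, 0))))).1
    rw [hsym u h1, hq _ h2]
  refine ⟨_cs, hman, ⟨?_, Topology.IsEmbedding.subtypeVal⟩⟩
  refine Manifold.IsImmersionOfComplement.isImmersion (F := ℝ) fun p => ?_
  refine Manifold.IsImmersionAtOfComplement.mk_of_charts (L p) (φ p) (ψ p)
    (by rw [hsrc]; exact hpψ p) (hpψ p) (IsManifold.chart_mem_maximalAtlas p) (hψ p)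
    (hsrc p).subset ?_
  intro u hu
  have hu' : u ∈ (φ p).target := by simpa using hu
  have h1 := hφ p _ ((φ p).map_target hu')
  rw [(φ p).right_inv hu'] at h1
  simpa using h1

variable [IsManifold (𝓡 (n + 1)) ∞ M] [T2Space M] [SecondCountableTopology M]
  {g : BilinField (n + 1) M}

theorem exists_isHypersurfaceStructure (hg : IsTransverseRiemannLorentz g) :
    ∃ cs : ChartedSpace (EuclideanSpace ℝ (Fin n)) (singularSet g),
      IsHypersurfaceStructure g cs := by
  refine exists_isSmoothEmbedding_of_slices fun p hp => ?_
  obtain ⟨E, hE, hEc, hb, -⟩ := exists_isSmoothVField_frame (d := n + 1) p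
  have hd : mfderiv (𝓡 (n + 1)) 𝓘(ℝ, ℝ) (fun x => (gram g E x).det) p ≠ 0 := by
    rw [(gram_det_eventuallyEq hEc).mfderiv_eq]
    exact hg.transverse p hp
  obtain ⟨ψ, hψ, hpψ, ℓ, hℓ, h⟩ := exists_chart_eq_linear (contMDiff_gram_det hg.smooth hE) hd
  obtain ⟨U, hU, hUo, hpU⟩ := eventually_nhds_iff.1 hb
  -- Restriction to `U` keeps the frame a basis, so that Σ is exactly the zero set of the
  -- determinant on the chart domain.
  refine ⟨ψ.restr U, restr_mem_maximalAtlas _ hψ hUo, ?_, ℓ, hℓ, fun x hx => ?_⟩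
  · rw [ψ.restr_source' U hUo]
    exact ⟨hpψ, hpU⟩
  · rw [ψ.restr_source' U hUo] at hx
    obtain ⟨b, hb⟩ := hU x hx.2
    rw [mem_singularSet_iff_det hg.symm hb, ← h x hx.1, ψ.restr_apply]

end Slices

/-! ### Brackets as commutators of derivations, and dual frames. -/

section BracketOnFunctions

variable {d : ℕ} {M : Type*} [TopologicalSpace M] [ChartedSpace (EuclideanSpace ℝ (Fin d)) M]
  [IsManifold (𝓡 d) ∞ M] {X Y : VField d M} {f : M → ℝ} {p : M}

/-- Pulling back a field inverts the derivative of the inverse chart, and the chain rule applies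
that derivative again. It moves derivations to the chart, where the commutator formula is available.
-/
theorem fderiv_comp_extChartAt_symm_mpullback {y : EuclideanSpace ℝ (Fin d)}
    (hy : y ∈ (extChartAt (𝓡 d) p).target)
    (hf : MDifferentiableAt (𝓡 d) 𝓘(ℝ, ℝ) f ((extChartAt (𝓡 d) p).symm y)) :
    fderiv ℝ (f ∘ (extChartAt (𝓡 d) p).symm) y
        (mpullbackWithin 𝓘(ℝ, EuclideanSpace ℝ (Fin d)) (𝓡 d) (extChartAt (𝓡 d) p).symm X
          (Set.range (𝓡 d)) y) = dirDeriv X f ((extChartAt (𝓡 d) p).symm y) := by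
  have : IsManifold (𝓡 d) 1 M := IsManifold.of_le (n := ∞) (by simp)
  have h1 := isInvertible_mfderivWithin_extChartAt_symm (I := 𝓡 d) hy
  have h2 := mdifferentiableWithinAt_extChartAt_symm (I := 𝓡 d) hy
  rw [modelWithCornersSelf_coe, Set.range_id] at h1 h2 ⊢
  rw [mdifferentiableWithinAt_univ] at h2
  rw [mpullbackWithin_apply, mfderivWithin_univ, dirDeriv, ← mfderiv_eq_fderiv,
    mfderiv_comp y hf h2]
  rw [mfderivWithin_univ] at h1
  have h3 := h1.self_apply_inverse (X ((extChartAt (𝓡 d) p).symm y))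
  exact congrArg _ h3

/-- The Lie bracket of vector fields is the commutator of the derivations. -/
theorem dirDeriv_mlieBracket (hX : IsSmoothVField X) (hY : IsSmoothVField Y)
    (hf : ContMDiff (𝓡 d) 𝓘(ℝ, ℝ) ∞ f) :
    dirDeriv (mlieBracket (𝓡 d) X Y) f p
      = dirDeriv X (dirDeriv Y f) p - dirDeriv Y (dirDeriv X f) p := by
  have : IsManifold (𝓡 d) 1 M := IsManifold.of_le (n := ∞) (by simp)
  have h2le : (2 : ℕ∞ω) ≤ ∞ := WithTop.coe_le_coe.2 (le_top : (2 : ℕ∞) ≤ ⊤)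
  have : IsManifold (𝓡 d) 2 M := IsManifold.of_le h2le
  set φ := extChartAt (𝓡 d) p with hφ
  set X' := mpullbackWithin 𝓘(ℝ, EuclideanSpace ℝ (Fin d)) (𝓡 d) φ.symm X (Set.range (𝓡 d))
    with hX'
  set Y' := mpullbackWithin 𝓘(ℝ, EuclideanSpace ℝ (Fin d)) (𝓡 d) φ.symm Y (Set.range (𝓡 d))
    with hY'
  have hp : φ.symm (φ p) = p := extChartAt_to_inv p
  have htar : ∀ᶠ y in 𝓝 (φ p), y ∈ φ.target := extChartAt_target_mem_nhds p
  have hr : φ.symm ⁻¹' Set.univ ∩ Set.range (𝓡 d) = Set.univ := by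
    rw [modelWithCornersSelf_coe, Set.range_id, Set.preimage_univ, Set.univ_inter]
  have hd : ∀ {Z : VField d M}, IsSmoothVField Z → DifferentiableAt ℝ
      (mpullbackWithin 𝓘(ℝ, EuclideanSpace ℝ (Fin d)) (𝓡 d) φ.symm Z (Set.range (𝓡 d)))
      (φ p) := fun hZ => by
    have := (hZ.mdifferentiableAt p).mdifferentiableWithinAt
      (s := Set.univ).differentiableWithinAt_mpullbackWithin_vectorField
    refine differentiableWithinAt_univ.1 ?_
    rw [← hr]
    exact this
  have hev : ∀ {Z : VField d M} {h : M → ℝ}, ContMDiff (𝓡 d) 𝓘(ℝ, ℝ) ∞ h →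
      (fun y => fderiv ℝ (h ∘ φ.symm) y (mpullbackWithin 𝓘(ℝ, EuclideanSpace ℝ (Fin d)) (𝓡 d)
        φ.symm Z (Set.range (𝓡 d)) y)) =ᶠ[𝓝 (φ p)] dirDeriv Z h ∘ φ.symm := fun hh => by
    filter_upwards [htar] with y hy
    exact fderiv_comp_extChartAt_symm_mpullback hy (hh.mdifferentiableAt (by simp))
  have hf' : ContDiffAt ℝ ∞ (f ∘ φ.symm) (φ p) := by
    rw [← contMDiffAt_iff_contDiffAt]
    have h1 := contMDiffWithinAt_extChartAt_symm_range (I := 𝓡 d) (n := ∞) p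
      (mem_extChartAt_target p)
    rw [modelWithCornersSelf_coe, Set.range_id, contMDiffWithinAt_univ] at h1
    exact hf.contMDiffAt.comp _ h1
  have key := fderiv_apply_lieBracket (𝕜 := ℝ) (n := ∞) hf'
    (by rwa [minSmoothness_of_isRCLikeNormedField]) (hd hY) (hd hX)
  have h2 : ∀ {Z : VField d M} {h : M → ℝ}, ContMDiff (𝓡 d) 𝓘(ℝ, ℝ) ∞ h →
      fderiv ℝ (h ∘ φ.symm) (φ p) (mpullbackWithin 𝓘(ℝ, EuclideanSpace ℝ (Fin d)) (𝓡 d)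
        φ.symm Z (Set.range (𝓡 d)) (φ p)) = dirDeriv Z h p := fun {Z h} hh => by
    have := (hev (Z := Z) hh).self_of_nhds
    dsimp only [Function.comp_apply] at this
    rw [hp] at this
    exact this
  rw [(hev hf).fderiv_eq, (hev hf).fderiv_eq, h2 (contMDiff_dirDeriv hX hf),
    h2 (contMDiff_dirDeriv hY hf)] at key
  rw [← key]
  have h3 : mfderiv (𝓡 d) 𝓘(ℝ, ℝ) f p = (fderiv ℝ (f ∘ φ.symm) (φ p)).comp
      (mfderiv (𝓡 d) 𝓘(ℝ, EuclideanSpace ℝ (Fin d)) φ p) := by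
    have h4 : f =ᶠ[𝓝 p] (f ∘ φ.symm) ∘ φ := by
      filter_upwards [extChartAt_source_mem_nhds (I := 𝓡 d) p] with x hx
      simp only [Function.comp_apply]
      rw [(extChartAt (𝓡 d) p).left_inv hx]
    rw [h4.mfderiv_eq, mfderiv_comp (I' := 𝓘(ℝ, EuclideanSpace ℝ (Fin d))) p
      (hf'.differentiableAt (by simp)).mdifferentiableAt
      (mdifferentiableAt_extChartAt (mem_chart_source _ p)), mfderiv_eq_fderiv]
    rfl
  have h5 : mlieBracket (𝓡 d) X Y p =
      (mfderiv (𝓡 d) 𝓘(ℝ, EuclideanSpace ℝ (Fin d)) φ p).inverse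
        (lieBracket ℝ X' Y' (φ p)) := by
    have h6 : ∀ (A B : EuclideanSpace ℝ (Fin d) → EuclideanSpace ℝ (Fin d)) (s : Set _),
        s = Set.univ → lieBracketWithin ℝ A B s (φ p) = lieBracket ℝ A B (φ p) := by
      rintro A B _ rfl
      rw [lieBracketWithin_univ]
    rw [← mlieBracketWithin_univ, mlieBracketWithin_apply]
    exact congrArg _ (h6 X' Y' _ hr)
  have h6 := (isInvertible_mfderiv_extChartAt (I := 𝓡 d)
    (mem_extChartAt_source p)).self_apply_inverse (lieBracket ℝ X' Y' (φ p))
  rw [dirDeriv, h3, h5]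
  exact congrArg _ h6

variable [T2Space M] [SecondCountableTopology M]

/-- Near every point there are smooth functions whose differentials form a frame dual to a frame of
smooth vector fields. -/
theorem exists_dual_frame (p : M) :
    ∃ (y : Fin d → M → ℝ) (E : Fin d → VField d M),
      (∀ a, ContMDiff (𝓡 d) 𝓘(ℝ, ℝ) ∞ (y a)) ∧ (∀ a, IsSmoothVField (E a)) ∧
      ∀ᶠ x in 𝓝 p, ∀ v : TangentSpace (𝓡 d) x, v = ∑ a, mvfderiv (𝓡 d) (y a) x v • E a x := by
  have : IsManifold (𝓡 d) 1 M := IsManifold.of_le (n := ∞) (by simp)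
  set φ := chartAt (EuclideanSpace ℝ (Fin d)) p with hφ
  have hsrc : φ.source ∈ 𝓝 p := φ.open_source.mem_nhds (mem_chart_source _ p)
  obtain ⟨E, hE, hEc, -, -⟩ := exists_isSmoothVField_frame (d := d) p
  have hy : ∀ a, ∃ y : M → ℝ, ContMDiff (𝓡 d) 𝓘(ℝ, ℝ) ∞ y ∧ y =ᶠ[𝓝 p] fun x => φ x a := fun a =>
    exists_contMDiff_eventuallyEq (by
      filter_upwards [hsrc] with x hx
      have h1 : ContMDiffAt (𝓡 d) 𝓘(ℝ, EuclideanSpace ℝ (Fin d)) ∞ φ x :=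
        (contMDiffOn_chart (I := 𝓡 d)).contMDiffAt (φ.open_source.mem_nhds hx)
      exact ((EuclideanSpace.proj a : EuclideanSpace ℝ (Fin d) →L[ℝ] ℝ).contMDiff.contMDiffAt).comp
        x h1)
  choose y hy hye using hy
  refine ⟨y, E, hy, hE, ?_⟩
  filter_upwards [hEc, hsrc, (Filter.eventually_all.2 fun a => (hye a).eventuallyEq_nhds)]
    with x h1 h2 h3 v
  have hx : x ∈ (extChartAt (𝓡 d) p).source := by rwa [extChartAt_source]
  have h4 : ∀ a, mvfderiv (𝓡 d) (y a) x v =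
      (show EuclideanSpace ℝ (Fin d) from
        mfderiv (𝓡 d) 𝓘(ℝ, EuclideanSpace ℝ (Fin d)) (extChartAt (𝓡 d) p) x v) a := by
    intro a
    have h5 : mfderiv (𝓡 d) 𝓘(ℝ, ℝ) (y a) x = (EuclideanSpace.proj a :
        EuclideanSpace ℝ (Fin d) →L[ℝ] ℝ).comp
        (mfderiv (𝓡 d) 𝓘(ℝ, EuclideanSpace ℝ (Fin d)) (extChartAt (𝓡 d) p) x) := by
      rw [(h3 a).mfderiv_eq]
      have := mfderiv_comp (I' := 𝓘(ℝ, EuclideanSpace ℝ (Fin d))) (I'' := 𝓘(ℝ, ℝ)) x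
        ((EuclideanSpace.proj a : EuclideanSpace ℝ (Fin d) →L[ℝ] ℝ).differentiableAt
          |>.mdifferentiableAt) (mdifferentiableAt_extChartAt (I := 𝓡 d) h2)
      rw [mfderiv_eq_fderiv, ContinuousLinearMap.fderiv] at this
      exact this
    change mfderiv (𝓡 d) 𝓘(ℝ, ℝ) (y a) x v = _
    rw [h5]
    rfl
  set w : EuclideanSpace ℝ (Fin d) :=
    mfderiv (𝓡 d) 𝓘(ℝ, EuclideanSpace ℝ (Fin d)) (extChartAt (𝓡 d) p) x v with hw
  have h6 := DFunLike.congr_fun (mfderivWithin_extChartAt_symm_comp_mfderiv_extChartAt'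
    (I := 𝓡 d) hx) v
  rw [modelWithCornersSelf_coe, Set.range_id, mfderivWithin_univ] at h6
  simp only [h4, h1, coordField]
  have h7 : w = ∑ a, w a • EuclideanSpace.single a (1 : ℝ) := by
    ext i
    simp [Finset.sum_apply, Pi.single_apply]
  have h8 : mfderiv (𝓡 d) (𝓡 d) (extChartAt (𝓡 d) p).symm (extChartAt (𝓡 d) p x) w = v := h6
  conv_lhs => rw [← h8, h7]
  exact (map_sum _ _ _).trans (Finset.sum_congr rfl fun a _ => map_smul _ _ _)

end BracketOnFunctions

/-! ### Related vector fields: naturality, extension and restriction. -/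

section RelatedFields

variable {n d : ℕ} {N M : Type*} [TopologicalSpace N] [ChartedSpace (EuclideanSpace ℝ (Fin n)) N]
  [TopologicalSpace M] [ChartedSpace (EuclideanSpace ℝ (Fin d)) M]
  {ι : N → M} {X Y Z : VField n N} {X' Y' Z' : VField d M}

/-- The vector fields `X` and `X'` are related by the map `ι`. -/
def IsRelated (ι : N → M) (X : VField n N) (X' : VField d M) : Prop :=
  ∀ s, mfderiv (𝓡 n) (𝓡 d) ι s (X s) = X' (ι s)

theorem IsRelated.dirDeriv_comp (h : IsRelated ι X X') {f : M → ℝ} {s : N}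
    (hf : MDifferentiableAt (𝓡 d) 𝓘(ℝ, ℝ) f (ι s)) (hι : MDifferentiableAt (𝓡 n) (𝓡 d) ι s) :
    dirDeriv X (f ∘ ι) s = dirDeriv X' f (ι s) := by
  rw [dirDeriv, mfderiv_comp (I' := 𝓡 d) s hf hι, dirDeriv, ← h s]
  rfl

/-- In immersion charts the map is u ↦ (u, 0) up to a linear isomorphism, and projection to the
first factor is a left inverse. -/
theorem exists_local_retraction (hι : Manifold.IsImmersion (𝓡 n) (𝓡 d) ∞ ι) (s : N) :
    ∃ ρ : M → N, (∀ᶠ x in 𝓝 (ι s), ContMDiffAt (𝓡 d) (𝓡 n) ∞ ρ x) ∧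
      ∀ᶠ s' in 𝓝 s, ρ (ι s') = s' := by
  have h := hι.isImmersionAt s
  have hw : ∀ s' ∈ h.domChart.source, h.codChart (ι s') = h.equiv (h.domChart s', 0) := by
    intro s' hs'
    have hm : h.domChart s' ∈ (h.domChart.extend (𝓡 n)).target := by
      simpa using h.domChart.map_source hs'
    have := h.writtenInCharts hm
    simpa [h.domChart.left_inv hs'] using this
  have hcont : ContinuousAt (fun x => (h.equiv.symm (h.codChart x)).1) (ι s) :=
    continuous_fst.continuousAt.comp (h.equiv.symm.continuous.continuousAt.comp
      (h.codChart.continuousAt h.mem_codChart_source))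
  refine ⟨fun x => h.domChart.symm (h.equiv.symm (h.codChart x)).1, ?_, ?_⟩
  · have h0 : (h.equiv.symm (h.codChart (ι s))).1 ∈ h.domChart.target := by
      rw [hw s h.mem_domChart_source, h.equiv.symm_apply_apply]
      exact h.domChart.map_source h.mem_domChart_source
    filter_upwards [hcont.eventually_mem (h.domChart.open_target.mem_nhds h0),
      h.codChart.open_source.mem_nhds h.mem_codChart_source] with x h1 h2
    have h3 : ContMDiffAt (𝓡 d) 𝓘(ℝ, EuclideanSpace ℝ (Fin d)) ∞ h.codChart x :=
      contMDiffAt_of_mem_maximalAtlas h.codChart_mem_maximalAtlas h2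
    have h4 : ContMDiffAt 𝓘(ℝ, EuclideanSpace ℝ (Fin n)) (𝓡 n) ∞ h.domChart.symm
        (h.equiv.symm (h.codChart x)).1 :=
      contMDiffAt_symm_of_mem_maximalAtlas h.domChart_mem_maximalAtlas h1
    have h5 : ContDiff ℝ ∞ fun v => (h.equiv.symm v).1 :=
      contDiff_fst.comp h.equiv.symm.contDiff
    exact h4.comp x (h5.contMDiff.contMDiffAt.comp x h3)
  · filter_upwards [h.domChart.open_source.mem_nhds h.mem_domChart_source] with s' hs'
    rw [hw s' hs', h.equiv.symm_apply_apply, h.domChart.left_inv hs']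

theorem injective_mfderiv_of_isImmersion (hι : Manifold.IsImmersion (𝓡 n) (𝓡 d) ∞ ι) (s : N) :
    Function.Injective (mfderiv (𝓡 n) (𝓡 d) ι s) := by
  obtain ⟨ρ, h1, h2⟩ := exists_local_retraction hι s
  have h3 : ρ ∘ ι =ᶠ[𝓝 s] id := h2
  have h4 := mfderiv_comp (I' := 𝓡 d) s (h1.self_of_nhds.mdifferentiableAt (by simp))
    (hι.contMDiff.mdifferentiableAt (by simp))
  rw [h3.mfderiv_eq, mfderiv_id] at h4
  refine Function.LeftInverse.injective (g := mfderiv (𝓡 d) (𝓡 n) ρ (ι s)) fun v => ?_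
  exact (DFunLike.congr_fun h4 v).symm

variable [IsManifold (𝓡 n) ∞ N] [IsManifold (𝓡 d) ∞ M]

/-- A tangent vector is determined by its action on the coordinate functions of a dual frame, and on
functions the bracket is a commutator, which relatedness carries through ι. -/
theorem IsRelated.mlieBracket [T2Space M] [SecondCountableTopology M]
    (hι : ContMDiff (𝓡 n) (𝓡 d) ∞ ι) (hX : IsSmoothVField X) (hY : IsSmoothVField Y)
    (hX' : IsSmoothVField X') (hY' : IsSmoothVField Y') (h : IsRelated ι X X')
    (h' : IsRelated ι Y Y') : IsRelated ι (mlieBracket (𝓡 n) X Y) (mlieBracket (𝓡 d) X' Y') := by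
  intro s
  obtain ⟨y, E, hy, -, hE⟩ := exists_dual_frame (d := d) (ι s)
  have hE := hE.self_of_nhds
  have hιs : ∀ s, MDifferentiableAt (𝓡 n) (𝓡 d) ι s := fun s =>
    hι.mdifferentiableAt (by simp)
  have hd : ∀ {f : M → ℝ}, ContMDiff (𝓡 d) 𝓘(ℝ, ℝ) ∞ f → ∀ x,
    MDifferentiableAt (𝓡 d) 𝓘(ℝ, ℝ) f x := fun hf x => hf.mdifferentiableAt (by simp)
  rw [hE (mfderiv (𝓡 n) (𝓡 d) ι s (VectorField.mlieBracket (𝓡 n) X Y s)),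
    hE (VectorField.mlieBracket (𝓡 d) X' Y' (ι s))]
  refine Finset.sum_congr rfl fun a _ => ?_
  congr 1
  have h1 : dirDeriv (VectorField.mlieBracket (𝓡 n) X Y) (y a ∘ ι) s =
      dirDeriv (VectorField.mlieBracket (𝓡 d) X' Y') (y a) (ι s) := by
    have h2 : dirDeriv X (y a ∘ ι) = dirDeriv X' (y a) ∘ ι :=
      funext fun s => h.dirDeriv_comp (hd (hy a) _) (hιs s)
    have h3 : dirDeriv Y (y a ∘ ι) = dirDeriv Y' (y a) ∘ ι :=
      funext fun s => h'.dirDeriv_comp (hd (hy a) _) (hιs s)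
    rw [dirDeriv_mlieBracket hX hY ((hy a).comp hι), dirDeriv_mlieBracket hX' hY' (hy a), h2, h3,
      h.dirDeriv_comp (hd (contMDiff_dirDeriv hY' (hy a)) _) (hιs s),
      h'.dirDeriv_comp (hd (contMDiff_dirDeriv hX' (hy a)) _) (hιs s)]
  rw [dirDeriv, mfderiv_comp (I' := 𝓡 d) s (hd (hy a) _) (hιs s)] at h1
  exact h1

theorem IsRelated.dualConn_eq [T2Space M] [SecondCountableTopology M] {g : BilinField d M}
    {k : BilinField n N} (hg : IsSmoothBilinField g)
    (hk : ∀ s v w, k s v w = g (ι s) (mfderiv (𝓡 n) (𝓡 d) ι s v) (mfderiv (𝓡 n) (𝓡 d) ι s w))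
    (hι : ContMDiff (𝓡 n) (𝓡 d) ∞ ι) (hX : IsSmoothVField X) (hY : IsSmoothVField Y)
    (hZ : IsSmoothVField Z) (hX' : IsSmoothVField X') (hY' : IsSmoothVField Y')
    (hZ' : IsSmoothVField Z') (h : IsRelated ι X X') (h' : IsRelated ι Y Y')
    (h'' : IsRelated ι Z Z') (s : N) : dualConn k X Y Z s = dualConn g X' Y' Z' (ι s) := by
  have hd : ∀ {X Y Z : VField n N} {X' Y' Z' : VField d M}, IsSmoothVField Y' →
      IsSmoothVField Z' → IsRelated ι X X' → IsRelated ι Y Y' → IsRelated ι Z Z' →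
      dirDeriv X (fun s => k s (Y s) (Z s)) s
        = dirDeriv X' (fun x => g x (Y' x) (Z' x)) (ι s) := fun hY hZ h h' h'' => by
    rw [← h.dirDeriv_comp ((hg.contMDiff_apply hY hZ).mdifferentiableAt (by simp))
      (hι.mdifferentiableAt (by simp))]
    congr 1
    ext s
    rw [hk, h' s, h'' s]
    rfl
  rw [dualConn, dualConn, hd hY' hZ' h h' h'', hd hZ' hX' h' h'' h, hd hX' hY' h'' h h',
    hk, hk, hk, IsRelated.mlieBracket hι hX hY hX' hY' h h' s,
    IsRelated.mlieBracket hι hY hZ hY' hZ' h' h'' s,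
    IsRelated.mlieBracket hι hZ hX hZ' hX' h'' h s, h s, h' s, h'' s]

variable [T2Space M] [SecondCountableTopology M]

/-- Vector fields on a closed embedded submanifold extend. -/
theorem exists_isRelated_extension (hι : Manifold.IsSmoothEmbedding (𝓡 n) (𝓡 d) ∞ ι)
    (hc : IsClosed (Set.range ι)) (hX : IsSmoothVField X) :
    ∃ X' : VField d M, IsSmoothVField X' ∧ IsRelated ι X X' := by
  -- The condition at x prescribes the pushforward at every preimage of x and is void off the range,
  -- which is closed; it is convex, so only a local extension is needed.
  suffices H : ∃ X' : VField d M, IsSmoothVField X' ∧ ∀ x, X' x ∈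
      {v | ∀ s, ∀ h : ι s = x, h ▸ mfderiv (𝓡 n) (𝓡 d) ι s (X s) = v} by
    obtain ⟨X', h1, h2⟩ := H
    exact ⟨X', h1, fun s => h2 (ι s) s rfl⟩
  refine exists_isSmoothVField_forall_mem (d := d) (M := M) _ ?_ ?_
  · intro x v hv w hw a b _ _ hab s hs
    rw [← hv s hs, ← hw s hs, ← add_smul, hab, one_smul]
  · intro x
    by_cases hx : x ∈ Set.range ι
    · obtain ⟨s, rfl⟩ := hx
      obtain ⟨ρ, hρ, hρι⟩ := exists_local_retraction hι.isImmersion s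
      obtain ⟨y, E, hy, hE, hyE⟩ := exists_dual_frame (d := d) (ι s)
      have hyι := fun a => contMDiff_dirDeriv hX ((hy a).comp hι.contMDiff)
      have hC : ∀ a, ∃ C : M → ℝ, ContMDiff (𝓡 d) 𝓘(ℝ, ℝ) ∞ C ∧
          C =ᶠ[𝓝 (ι s)] dirDeriv X (y a ∘ ι) ∘ ρ := fun a =>
        exists_contMDiff_eventuallyEq (hρ.mono fun x hx => (hyι a).contMDiffAt.comp x hx)
      choose C hC hCe using hC
      refine ⟨fun x => ∑ a, (C a • E a) x, IsSmoothVField.sum fun a => (hE a).smul (hC a), ?_⟩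
      -- The embedding hypothesis enters here: a point s' whose image is near ι s is itself near s,
      -- so ρ recovers it.
      have hev : ∀ᶠ x in 𝓝 (ι s), ∀ s', ι s' = x → ρ (ι s') = s' := by
        have := hι.isEmbedding.isInducing.nhds_eq_comap s
        rw [this, Filter.eventually_comap] at hρι
        exact hρι
      filter_upwards [hev, Filter.eventually_all.2 hCe, hyE] with x h1 h2 h3
      rintro s' rfl
      refine (h3 _).trans (Finset.sum_congr rfl fun a _ => ?_)
      rw [Pi.smul_apply', h2, Function.comp_apply, h1 s' rfl, dirDeriv,
        mfderiv_comp (I' := 𝓡 d) s' ((hy a).mdifferentiableAt (by simp))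
        (hι.contMDiff.mdifferentiableAt (by simp))]
      rfl
    · refine ⟨0, contMDiff_zeroSection _ _, ?_⟩
      filter_upwards [hc.isOpen_compl.mem_nhds hx] with x hx s hs
      exact (hx ⟨s, hs⟩).elim

/-- Vector fields tangent to an immersed submanifold restrict to it. -/
theorem exists_isRelated_restriction [T2Space N] [SecondCountableTopology N]
    (hι : Manifold.IsImmersion (𝓡 n) (𝓡 d) ∞ ι) (hX' : IsSmoothVField X')
    (ht : ∀ s, ∃ v, mfderiv (𝓡 n) (𝓡 d) ι s v = X' (ι s)) :
    ∃ X : VField n N, IsSmoothVField X ∧ IsRelated ι X X' := by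
  choose X hX using ht
  have hrel : IsRelated ι X X' := hX
  refine ⟨X, fun s => ?_, hrel⟩
  obtain ⟨ρ, hρ, hρι⟩ := exists_local_retraction hι s
  obtain ⟨y, E, hy, hE, hyE⟩ := exists_dual_frame (d := n) s
  have hC : ∀ a, ∃ C : M → ℝ, ContMDiff (𝓡 d) 𝓘(ℝ, ℝ) ∞ C ∧ C =ᶠ[𝓝 (ι s)] y a ∘ ρ := fun a =>
    exists_contMDiff_eventuallyEq (hρ.mono fun x hx => (hy a).contMDiffAt.comp x hx)
  choose C hC hCe using hC
  -- The pointwise lift `X` satisfies X(y a) = X'(C a) ∘ ι near s, where `C a` extends y a ∘ ρ;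
  -- these coefficients are smooth.
  have hW : IsSmoothVField fun s => ∑ a, ((dirDeriv X' (C a) ∘ ι) • E a) s :=
    IsSmoothVField.sum fun a => (hE a).smul ((contMDiff_dirDeriv hX' (hC a)).comp hι.contMDiff)
  have hyC : ∀ a, y a =ᶠ[𝓝 s] C a ∘ ι := by
    refine Filter.eventually_all.1 ?_
    filter_upwards [hι.contMDiff.continuous.continuousAt.eventually
      (Filter.eventually_all.2 hCe), hρι] with s' h1 h2 a
    rw [Function.comp_apply, h1, Function.comp_apply, h2]
  refine (hW s).congr_of_eventuallyEq ?_
  filter_upwards [hyE, Filter.eventually_all.2 fun a => (hyC a).eventuallyEq_nhds] with s' h1 h2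
  refine congrArg _ ((h1 (X s')).trans (Finset.sum_congr rfl fun a _ => ?_))
  have h3 : dirDeriv X (y a) s' = dirDeriv X' (C a) (ι s') := by
    rw [dirDeriv_congr (h2 a), hrel.dirDeriv_comp ((hC a).mdifferentiableAt (by simp))
      (hι.contMDiff.mdifferentiableAt (by simp))]
  rw [Pi.smul_apply', Function.comp_apply, ← h3]
  rfl

end RelatedFields

/-! ### The induced metric on Σ and its curvature. -/

section SigmaFlat

variable {n : ℕ} {M : Type*} [TopologicalSpace M]
  [ChartedSpace (EuclideanSpace ℝ (Fin (n + 1))) M] {g : BilinField (n + 1) M}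

/-- Cauchy–Schwarz for a semidefinite form, through the discriminant of t ↦ g(v + t w, v + t w). -/
theorem mem_radical_of_apply_self_eq_zero {p : M}
    (hs : ∀ (p : M) (v w : TangentSpace (𝓡 (n + 1)) p), g p v w = g p w v)
    (h : ∀ v : TangentSpace (𝓡 (n + 1)) p, 0 ≤ g p v v) {v : TangentSpace (𝓡 (n + 1)) p}
    (hv : g p v v = 0) : v ∈ radical g p := by
  change g p v = 0
  ext w
  have h1 : ∀ t : ℝ, 0 ≤ g p w w * (t * t) + (2 * g p v w) * t + 0 := fun t => by
    have := h (v + t • w)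
    simp only [map_add, map_smul, add_apply, smul_apply, smul_eq_mul, hv, hs p w v] at this
    rw [← mul_assoc]
    linarith
  have h2 := discrim_le_zero fun t => h1 t
  rw [discrim] at h2
  have h3 : (g p v w) ^ 2 ≤ 0 := by nlinarith
  exact pow_eq_zero_iff two_ne_zero |>.1 (le_antisymm h3 (sq_nonneg _))

theorem inducedMetric_apply [ChartedSpace (EuclideanSpace ℝ (Fin n)) (singularSet g)]
    (s : singularSet g) (v w : TangentSpace (𝓡 n) s) :
    inducedMetric g s v w =
      g s (mfderiv (𝓡 n) (𝓡 (n + 1)) (Subtype.val : singularSet g → M) s v)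
        (mfderiv (𝓡 n) (𝓡 (n + 1)) (Subtype.val : singularSet g → M) s w) := rfl

variable [T2Space M] [SecondCountableTopology M] [IsManifold (𝓡 (n + 1)) ∞ M]

theorem isClosed_range_subtypeVal (hg : IsTransverseRiemannLorentz g) :
    IsClosed (Set.range (Subtype.val : singularSet g → M)) := by
  rw [Subtype.range_coe]
  exact isOpen_compl_iff.1 (isOpen_regularPart hg.smooth hg.symm)

variable [ChartedSpace (EuclideanSpace ℝ (Fin n)) (singularSet g)]
  {X Y Z T V : VField n (singularSet g)} {X' Y' Z' T' V' : VField (n + 1) M}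

/-- The determinant vanishes along Σ, which gives one inclusion; both spaces have dimension n. Thus
the kernel defining `tangentSigma` is the tangent space for any hypersurface structure. -/
theorem range_mfderiv_subtypeVal (hg : IsTransverseRiemannLorentz g)
    (hι : Manifold.IsSmoothEmbedding (𝓡 n) (𝓡 (n + 1)) ∞ (Subtype.val : singularSet g → M))
    (s : singularSet g) :
    LinearMap.range (mfderiv (𝓡 n) (𝓡 (n + 1)) (Subtype.val : singularSet g → M) s).toLinearMap
      = tangentSigma g s := by
  have h1 : FiniteDimensional ℝ (TangentSpace (𝓡 (n + 1)) (s : M)) :=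
    inferInstanceAs (FiniteDimensional ℝ (EuclideanSpace ℝ (Fin (n + 1))))
  have hn : Module.finrank ℝ (TangentSpace (𝓡 n) s) = n :=
    finrank_euclideanSpace_fin (𝕜 := ℝ) (n := n)
  have hn1 : Module.finrank ℝ (TangentSpace (𝓡 (n + 1)) (s : M)) = n + 1 :=
    finrank_euclideanSpace_fin (𝕜 := ℝ) (n := n + 1)
  refine Submodule.eq_of_le_of_finrank_eq ?_ ?_
  · rintro _ ⟨v, rfl⟩
    obtain ⟨E, hE, hEc, hb, -⟩ := exists_isSmoothVField_frame (d := n + 1) (s : M)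
    have h2 := mfderiv_comp (I' := 𝓡 (n + 1)) s
      ((contMDiff_gram_det hg.smooth hE).mdifferentiableAt (by simp))
      (hι.contMDiff.mdifferentiableAt (by simp) (x := s))
    have h3 : (fun x => (gram g E x).det) ∘ (Subtype.val : singularSet g → M)
        =ᶠ[𝓝 s] fun _ => 0 := by
      filter_upwards [hι.contMDiff.continuous.continuousAt.eventually hb] with s' ⟨b, hb⟩
      exact (mem_singularSet_iff_det hg.symm hb).1 s'.2
    rw [h3.mfderiv_eq, mfderiv_const, (gram_det_eventuallyEq hEc).mfderiv_eq] at h2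
    exact (DFunLike.congr_fun h2 v).symm
  · rw [LinearMap.finrank_range_of_inj
      (injective_mfderiv_of_isImmersion hι.isImmersion s), hn]
    have h4 := Module.Dual.finrank_ker_add_one_of_ne_zero
      (f := (mfderiv (𝓡 (n + 1)) 𝓘(ℝ, ℝ) (gramDet g s) (s : M)).toLinearMap)
      fun h => hg.transverse s s.2 (ContinuousLinearMap.coe_injective h)
    rw [hn1, add_left_inj] at h4
    exact h4.symm

theorem IsRelated.isTangentToSigma (hg : IsTransverseRiemannLorentz g)
    (hι : Manifold.IsSmoothEmbedding (𝓡 n) (𝓡 (n + 1)) ∞ (Subtype.val : singularSet g → M))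
    (hX' : IsSmoothVField X') (h : IsRelated Subtype.val X X') : IsTangentToSigma g X' := by
  refine ⟨hX', fun p hp => ?_⟩
  rw [← range_mfderiv_subtypeVal hg hι ⟨p, hp⟩]
  exact ⟨_, h ⟨p, hp⟩⟩

/-- On Σ a null vector of the semidefinite form g is radical, and the radical is transverse to Σ. -/
theorem inducedMetric_pos (hg : IsTransverseRiemannLorentz g) (hrad : HasTransverseRadical g)
    (hι : Manifold.IsSmoothEmbedding (𝓡 n) (𝓡 (n + 1)) ∞ (Subtype.val : singularSet g → M))
    (s : singularSet g) {v : TangentSpace (𝓡 n) s} (hv : v ≠ 0) : 0 < inducedMetric g s v v := by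
  rw [inducedMetric_apply]
  refine lt_of_le_of_ne (nonneg_of_mem_singularSet hg s.2 _) fun h => hv ?_
  have h1 := mem_radical_of_apply_self_eq_zero hg.symm (nonneg_of_mem_singularSet hg s.2) h.symm
  have h2 : mfderiv (𝓡 n) (𝓡 (n + 1)) (Subtype.val : singularSet g → M) s v
      ∈ tangentSigma g s := by
    rw [← range_mfderiv_subtypeVal hg hι]
    exact ⟨v, rfl⟩
  have h3 := Submodule.disjoint_def.1 (hrad s s.2).disjoint _ h1 h2
  exact injective_mfderiv_of_isImmersion hι.isImmersion s (h3.trans (map_zero _).symm)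

theorem mem_regularPart_inducedMetric (hg : IsTransverseRiemannLorentz g)
    (hrad : HasTransverseRadical g)
    (hι : Manifold.IsSmoothEmbedding (𝓡 n) (𝓡 (n + 1)) ∞ (Subtype.val : singularSet g → M))
    (s : singularSet g) : s ∈ regularPart (inducedMetric g) := fun hs => by
  obtain ⟨v, hv, h⟩ := mem_singularSet_iff.1 hs
  refine (inducedMetric_pos hg hrad hι s hv).ne' ?_
  rw [h]
  rfl

variable [IsManifold (𝓡 n) ∞ (singularSet g)]

/-- The covariant derivative of the induced metric is the restriction of that of `g`. -/
theorem nabla_inducedMetric_eq (hg : IsTransverseRiemannLorentz g) (hrad : HasTransverseRadical g)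
    (hι : Manifold.IsSmoothEmbedding (𝓡 n) (𝓡 (n + 1)) ∞ (Subtype.val : singularSet g → M))
    (hX : IsSmoothVField X) (hY : IsSmoothVField Y) (hX' : IsSmoothVField X')
    (hY' : IsSmoothVField Y') (h : IsRelated Subtype.val X X') (h' : IsRelated Subtype.val Y Y')
    (hV' : IsNablaExtension g X' Y' V') (hV : IsRelated Subtype.val V V') :
    nabla (inducedMetric g) X Y = V := by
  ext1 s
  refine nabla_eq (mem_regularPart_inducedMetric hg hrad hι s) fun Z hZ => ?_
  obtain ⟨Z', hZ', hZZ'⟩ := exists_isRelated_extension hι (isClosed_range_subtypeVal hg) hZ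
  rw [IsRelated.dualConn_eq hg.smooth inducedMetric_apply hι.contMDiff hX hY hZ hX' hY' hZ' h h'
    hZZ' s, inducedMetric_apply, hV s, hZZ' s]
  exact hV'.apply_eq hg hX' hY' hZ' s

/-- Σ is totally geodesic: the extension of ∇_{X'} Y' is tangent to Σ, hence restricts to a smooth
field, which is the covariant derivative of g_Σ. Smoothness and relatedness of the result allow the
lemma to be iterated for second derivatives. -/
theorem exists_nabla_inducedMetric (hg : IsTransverseRiemannLorentz g)
    (hrad : HasTransverseRadical g) (hflat : IsFlatOn g (regularPart g))
    (hι : Manifold.IsSmoothEmbedding (𝓡 n) (𝓡 (n + 1)) ∞ (Subtype.val : singularSet g → M))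
    (hX : IsSmoothVField X) (hY : IsSmoothVField Y) (hX' : IsSmoothVField X')
    (hY' : IsSmoothVField Y') (h : IsRelated Subtype.val X X') (h' : IsRelated Subtype.val Y Y') :
    ∃ V' : VField (n + 1) M, IsNablaExtension g X' Y' V' ∧
      IsSmoothVField (nabla (inducedMetric g) X Y) ∧
      IsRelated Subtype.val (nabla (inducedMetric g) X Y) V' := by
  have hX't := h.isTangentToSigma hg hι hX'
  have hY't := h'.isTangentToSigma hg hι hY'
  have hIII := isIIIFlat_of_isFlatOn hg hrad hflat
  obtain ⟨R, hR⟩ := hIII.1.1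
  obtain ⟨V', hV', -⟩ := hIII.2 R hR X' Y' hX't hY't
  have hVt := hV'.isTangentToSigma hg hrad hflat hIII.1 hX't hY't
  obtain ⟨V, hV, hVV'⟩ := exists_isRelated_restriction hι.isImmersion hV'.1 fun s => by
    have := hVt.2 s s.2
    rw [← range_mfderiv_subtypeVal hg hι] at this
    exact this
  rw [nabla_inducedMetric_eq hg hrad hι hX hY hX' hY' h h' hV' hVV']
  exact ⟨V', hV', hV, hVV'⟩

theorem isFlatOn_inducedMetric (hg : IsTransverseRiemannLorentz g)
    (hrad : HasTransverseRadical g) (hflat : IsFlatOn g (regularPart g))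
    (hι : Manifold.IsSmoothEmbedding (𝓡 n) (𝓡 (n + 1)) ∞ (Subtype.val : singularSet g → M)) :
    IsFlatOn (inducedMetric g) Set.univ := by
  intro X Y Z T hX hY hZ hT s _
  have hcl := isClosed_range_subtypeVal hg
  obtain ⟨X', hX', hXX'⟩ := exists_isRelated_extension hι hcl hX
  obtain ⟨Y', hY', hYY'⟩ := exists_isRelated_extension hι hcl hY
  obtain ⟨Z', hZ', hZZ'⟩ := exists_isRelated_extension hι hcl hZ
  obtain ⟨T', hT', hTT'⟩ := exists_isRelated_extension hι hcl hT
  obtain ⟨A', hA', hA, hAA'⟩ := exists_nabla_inducedMetric hg hrad hflat hι hY hZ hY' hZ' hYY' hZZ'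
  obtain ⟨B', hB', hB, hBB'⟩ := exists_nabla_inducedMetric hg hrad hflat hι hX hZ hX' hZ' hXX' hZZ'
  obtain ⟨U', hU', hU, hUU'⟩ :=
    exists_nabla_inducedMetric hg hrad hflat hι hX hA hX' hA'.1 hXX' hAA'
  obtain ⟨V', hV', hV, hVV'⟩ :=
    exists_nabla_inducedMetric hg hrad hflat hι hY hB hY' hB'.1 hYY' hBB'
  obtain ⟨W', hW', hW, hWW'⟩ :=
    exists_nabla_inducedMetric hg hrad hflat hι (hX.mlieBracket hY) hZ (hX'.mlieBracket hY') hZ'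
      (IsRelated.mlieBracket hι.contMDiff hX hY hX' hY' hXX' hYY') hZZ'
  have hXY := hX'.mlieBracket hY'
  -- The vanishing of K(X', Y', Z', T') on 𝕄, continued to Σ by density; the remaining lines
  -- identify it with the covariant curvature of g_Σ.
  have h1 : dualConn g X' A' T' s - dualConn g Y' B' T' s
      - dualConn g (VectorField.mlieBracket (𝓡 (n + 1)) X' Y') Z' T' s = 0 := by
    refine eq_of_dense_of_eventually (dense_regularPart hg) (p := (s : M))
      (f := fun p => dualConn g X' A' T' p - dualConn g Y' B' T' p
        - dualConn g (VectorField.mlieBracket (𝓡 (n + 1)) X' Y') Z' T' p)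
      (h := fun _ => (0 : ℝ))
      (((contMDiff_dualConn hg.smooth hX' hA'.1 hT').sub
        (contMDiff_dualConn hg.smooth hY' hB'.1 hT')).sub
        (contMDiff_dualConn hg.smooth hXY hZ' hT')).continuous.continuousAt
      continuousAt_const (.of_forall fun x hx => ?_)
    rw [← hflat X' Y' Z' T' hX' hY' hZ' hT' x hx]
    exact (covCurvature_eq hg.smooth hg.symm hx hX' hY' hZ' hT' hA'.1 hB'.1
      (hA'.eventuallyEq hg hx) (hB'.eventuallyEq hg hx)).symm
  rw [covCurvature, curvature, inducedMetric_apply]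
  simp only [map_sub, sub_apply]
  rw [hUU' s, hVV' s, hWW' s, hTT' s, hU'.apply_eq hg hX' hA'.1 hT',
    hV'.apply_eq hg hY' hB'.1 hT', hW'.apply_eq hg hXY hZ' hT', h1]

end SigmaFlat

theorem isSigmaFlat_of_isFlatOn {n : ℕ} {M : Type*} [TopologicalSpace M] [T2Space M]
    [SecondCountableTopology M] [ChartedSpace (EuclideanSpace ℝ (Fin (n + 1))) M]
    [IsManifold (𝓡 (n + 1)) ∞ M] {g : BilinField (n + 1) M} (hg : IsTransverseRiemannLorentz g)
    (hrad : HasTransverseRadical g) (hflat : IsFlatOn g (regularPart g)) : IsSigmaFlat g := by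
  refine ⟨exists_isHypersurfaceStructure hg, fun cs h => ?_⟩
  have := h.1
  exact ⟨fun s v hv => inducedMetric_pos hg hrad h.2 s hv,
    isFlatOn_inducedMetric hg hrad hflat h.2⟩

end RiemannLorentz

end

theorem mainTheorem5 (n : ℕ) (hn : 1 ≤ n)
    (M : Type*) [TopologicalSpace M] [T2Space M] [SecondCountableTopology M] [ConnectedSpace M]
    [ChartedSpace (EuclideanSpace ℝ (Fin (n + 1))) M] [IsManifold (𝓡 (n + 1)) ∞ M]
    (g : RiemannLorentz.BilinField (n + 1) M)
    (hg : RiemannLorentz.IsTransverseRiemannLorentz g)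
    (hrad : RiemannLorentz.HasTransverseRadical g)
    (hflat : RiemannLorentz.IsFlatOn g (RiemannLorentz.regularPart g)) :
    RiemannLorentz.IsIIIFlat g ∧ RiemannLorentz.IsSigmaFlat g := by
  exact ⟨RiemannLorentz.isIIIFlat_of_isFlatOn hg hrad hflat,
    RiemannLorentz.isSigmaFlat_of_isFlatOn hg hrad hflat⟩
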